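/- Let $\mathcal H$ be a finite-dimensional complex Hilbert space (inner product antilinear in the first variable) with an antiunitary involution $\mathfrak A$, i.e. $\mathfrak A$ is antilinear, $\mathfrak A^2=1$ and $\langle\mathfrak A\varphi_1,\mathfrak A\varphi_2\rangle=\langle\varphi_2,\varphi_1\rangle$. Let $P$ be a basis projection, i.e. an orthogonal projection on $\mathcal H$ with $\mathfrak AP\mathfrak A=1-P$, put $\mathfrak h_P=\operatorname{ran}P$, and let $\psi_1,\dots,\psi_n$ be an orthonormal basis of $\mathfrak h_P$. For $N\in\mathbb N_0$ let $\mathcal H^{(0)},\dots,\mathcal H^{(N)}$ be copies of $\mathcal H$, write $\varphi^{(q)}$ for the copy of $\varphi\in\mathcal H$ in $\mathcal H^{(q)}$, and let $\mathcal G=\wedge^*\big(\bigoplus_{q=0}^N\mathcal H^{(q)}\big)$ be the complex Grassmann algebra, with the involution $*$ that is antilinear, satisfies $1^*=1$ and $(\xi\wedge\zeta)^*=\zeta^*\wedge\xi^*$, and maps $\varphi^{(q)}$ to $(\mathfrak A\varphi)^{(q)}$. *Circle product.* For $k\in\{0,\dots,N\}$ adjoin one further copy $\mathcal H^{(\mathrm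 a)}$ of $\mathcal H$. For an orthonormal basis $\chi_1,\dots,\chi_n$ of $\mathfrak h_P$ let $\langle\mathfrak h_P^{(p)},\mathfrak h_P^{(q)}\rangle=\sum_j(\mathfrak A\chi_j)^{(p)}\wedge\chi_j^{(q)}$ and let $\int_P\mathrm d(\mathcal H^{(\mathrm a)})=\prod_{j}\frac{\delta}{\delta\chi_j^{(\mathrm a)}}\frac{\delta}{\delta(\mathfrak A\chi_j)^{(\mathrm a)}}$ be the Berezin integral, where $\delta/\delta\varphi^{(\mathrm a)}$ is the antiderivation that sends $\tilde\varphi^{(\mathrm a)}$ to $\langle\varphi,\tilde\varphi\rangle$ and the other copies to $0$. For $\xi,\zeta\in\mathcal G$ define $$\xi\circ_P^{(k)}\zeta=(-1)^{\frac{\dim\mathcal H}{2}}\int_P\mathrm d(\mathcal H^{(\mathrm a)})\;\varkappa'(\xi)\,\varkappa''(\zeta)\,e^{-\langle\mathfrak h_P^{(k)},\mathfrak h_P^{(k)}\rangle}e^{\langle\mathfrak h_P^{(k)},\mathfrak h_P^{(\mathrm a)}\rangle}e^{-\langle\mathfrak h_P^{(\mathrm a)},\mathfrak h_P^{(\mathrm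 a)}\rangle}e^{\langle\mathfrak h_P^{(\mathrm a)},\mathfrak h_P^{(k)}\rangle},$$ with exterior products and exponentials on the right-hand side, where $\varkappa'$ and $\varkappa''$ are the homomorphisms of Grassmann algebras that leave the copies other than $k$ in place and satisfy, for $\varphi\in\mathfrak h_P$, $\varkappa'(\varphi^{(k)})=\varphi^{(\mathrm a)}$, $\varkappa'((\mathfrak A\varphi)^{(k)})=(\mathfrak A\varphi)^{(k)}$, $\varkappa''(\varphi^{(k)})=\varphi^{(k)}$, $\varkappa''((\mathfrak A\varphi)^{(k)})=(\mathfrak A\varphi)^{(\mathrm a)}$. The statement holds for every choice of the basis $(\chi_j)$, which need not be $(\psi_j)$. *Displacement operators.* Let $\boldsymbol\psi^{(q)}=(\psi_1^{(q)},(\mathfrak A\psi_1)^{(q)},\dots,\psi_n^{(q)},(\mathfrak A\psi_n)^{(q)})^{\mathrm T}$, $\mathcal J=\begin{pmatrix}0&1\\1&0\end{pmatrix}^{\oplus n}$, and $(x,\mathcal Jy)=x^{\mathrm T}\mathcal Jy$ with entries multiplied by $\wedge$. For $x\in\mathcal G^{2n}$ put $$\mathbb T_k(x)=\exp\!\big(-(x,\mathcal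 J\boldsymbol\psi^{(k)})\big),$$ where, here and below, $\exp(a)=1+\sum_{r\ge1}a^r/r!$ with powers taken for the product $\circ_P^{(k)}$. **Lemma.** Let $k,l,m\in\{0,\dots,N\}$ with $k\ne l$ and $k\ne m$. Then, for every $i\in\{1,\dots,n\}$, $$\mathbb T_k(\boldsymbol\psi^{(l)})^*\circ_P^{(k)}\psi_i^{(k)}\circ_P^{(k)}\mathbb T_k(\boldsymbol\psi^{(l)})=\psi_i^{(k)}+\psi_i^{(l)},$$ $$\mathbb T_k(\boldsymbol\psi^{(l)})^*\circ_P^{(k)}(\mathfrak A\psi_i)^{(k)}\circ_P^{(k)}\mathbb T_k(\boldsymbol\psi^{(l)})=(\mathfrak A\psi_i)^{(k)}+(\mathfrak A\psi_i)^{(l)};$$ thus, entrywise, $\mathbb T_k(\boldsymbol\psi^{(l)})^*\circ_P^{(k)}\boldsymbol\psi^{(k)}\circ_P^{(k)}\mathbb T_k(\boldsymbol\psi^{(l)})=\boldsymbol\psi^{(k)}+\boldsymbol\psi^{(l)}$. Moreover $$\mathbb T_k(\boldsymbol\psi^{(l)}+\boldsymbol\psi^{(m)})=\mathbb T_k(\boldsymbol\psi^{(l)})\circ_P^{(k)}\mathbb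 T_k(\boldsymbol\psi^{(m)})\circ_P^{(k)}\exp\!\Big(+\tfrac12\big(\boldsymbol\psi^{(l)},\mathcal J\boldsymbol\psi^{(m)}\big)\Big).$$ -/

import Mathlib

noncomputable section

namespace GrassmannWeyl

/-- `A` is an antiunitary involution, i.e. `(H, A)` is a self-dual Hilbert space. -/
structure IsSelfDual {H : Type*} [NormedAddCommGroup H] [InnerProductSpace ℂ H]
    (A : H →ₗ⋆[ℂ] H) : Prop where
  involutive : ∀ x, A (A x) = x
  inner_map : ∀ x y, inner ℂ (A x) (A y) = inner ℂ y x

/-- `P` is a basis projection of `(H, A)`: an orthogonal projection with `A P A = 1 - P`. -/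
structure IsBasisProjection {H : Type*} [NormedAddCommGroup H] [InnerProductSpace ℂ H]
    (A : H →ₗ⋆[ℂ] H) (P : H →ₗ[ℂ] H) : Prop where
  isSymmetricProjection : P.IsSymmetricProjection
  conj_eq : ∀ x, A (P (A x)) = x - P x

/-- The Grassmann algebra of the direct sum of copies `H^(q)` of `H`, indexed by `q : ι`. -/
abbrev Grassmann (ι H : Type*) [AddCommGroup H] [Module ℂ H] : Type _ :=
  ExteriorAlgebra ℂ (ι → H)

section Basic

variable {ι H : Type*} [DecidableEq ι] [NormedAddCommGroup H] [InnerProductSpace ℂ H]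

/-- The copy `φ^(q)` of the vector `φ`, as an element of degree one. -/
def copy (q : ι) (φ : H) : Grassmann ι H :=
  ExteriorAlgebra.ι ℂ (Pi.single q φ)

/-- The exponential series `∑ xⁿ / n!`, where the powers are those of the product `mul`; the sum
is taken in the canonical topology of a complex vector space (the module topology). -/
def expSeries (mul : Grassmann ι H → Grassmann ι H → Grassmann ι H) (x : Grassmann ι H) :
    Grassmann ι H :=
  letI : TopologicalSpace (Grassmann ι H) := moduleTopology ℂ (Grassmann ι H)
  ∑' n : ℕ, ((n.factorial : ℂ)⁻¹) • (mul x)^[n] 1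

/-- The exponential for the exterior product. -/
def wedgeExp (x : Grassmann ι H) : Grassmann ι H :=
  expSeries (fun ξ ζ => ξ * ζ) x

/-- The Berezin derivative `δ/δφ^(q)`: the antiderivation of the Grassmann algebra that sends a
degree one element `v` to the scalar `⟨φ, v_q⟩`. -/
def berezinDeriv (q : ι) (φ : H) : Module.End ℂ (Grassmann ι H) :=
  CliffordAlgebra.contractLeft ((innerₛₗ ℂ φ) ∘ₗ (LinearMap.proj q : (ι → H) →ₗ[ℂ] H))

variable (A : H →ₗ⋆[ℂ] H) {P : H →ₗ[ℂ] H} {n : ℕ}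
  (χ : OrthonormalBasis (Fin n) ℂ (LinearMap.range P))

/-- The Berezin integral over the copy `H^(q)`, the product over `j` of
`(δ/δχ_j^(q)) (δ/δ(Aχ_j)^(q))`. -/
def berezinIntegral (q : ι) : Module.End ℂ (Grassmann ι H) :=
  (List.ofFn fun j : Fin n => berezinDeriv q (χ j : H) * berezinDeriv q (A (χ j : H))).prod

/-- The element `⟨𝔥_P^(p), 𝔥_P^(q)⟩ = ∑_j (Aχ_j)^(p) ∧ χ_j^(q)`. -/
def bilin (p q : ι) : Grassmann ι H :=
  ∑ j : Fin n, copy p (A (χ j : H)) * copy q (χ j : H)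

end Basic

section Circle

variable {ι H : Type*} [Fintype ι] [DecidableEq ι]
  [NormedAddCommGroup H] [InnerProductSpace ℂ H]

/-- The relabelling of copies `ϰ_{(k,k)}^{(a,b)}`: on the copy `k`, the part in `ran (1 - P)` (which
is `A (ran P)`) is moved to the copy `a` and the part in `ran P` to the copy `b`; all the other
copies stay in place. The target has one more copy, with the label `none`. -/
def kappa (P : H →ₗ[ℂ] H) (k : ι) (a b : Option ι) :
    Grassmann ι H →ₐ[ℂ] Grassmann (Option ι) H :=
  ExteriorAlgebra.map
    (LinearMap.single ℂ (fun _ : Option ι => H) a ∘ₗ (LinearMap.id - P) ∘ₗ LinearMap.proj k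
      + LinearMap.single ℂ (fun _ : Option ι => H) b ∘ₗ P ∘ₗ LinearMap.proj k
      + ∑ q ∈ Finset.univ.erase k,
          LinearMap.single ℂ (fun _ : Option ι => H) (some q) ∘ₗ LinearMap.proj q)

/-- Identification of the elements that do not involve the auxiliary copy `none` with elements of
the original Grassmann algebra. -/
def forget : Grassmann (Option ι) H →ₐ[ℂ] Grassmann ι H :=
  ExteriorAlgebra.map (LinearMap.funLeft ℂ H (some : ι → Option ι))

/-- The circle product `∘_P^(k)` on the copy `k`; the other copies are spectators, and the Berezin
integral runs over the auxiliary copy `none`. -/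
def circ (A : H →ₗ⋆[ℂ] H) {P : H →ₗ[ℂ] H} {n : ℕ}
    (χ : OrthonormalBasis (Fin n) ℂ (LinearMap.range P)) (k : ι) (ξ ζ : Grassmann ι H) :
    Grassmann ι H :=
  (-1 : ℂ) ^ (Module.finrank ℂ H / 2) •
    forget (berezinIntegral A χ none
      (kappa P k (some k) none ξ * kappa P k none (some k) ζ
        * wedgeExp (-bilin A χ (some k) (some k)) * wedgeExp (bilin A χ (some k) none)
        * wedgeExp (-bilin A χ none none) * wedgeExp (bilin A χ none (some k))))

/-- The exponential for the circle product `∘_P^(k)`. -/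
def circExp (A : H →ₗ⋆[ℂ] H) {P : H →ₗ[ℂ] H} {n : ℕ}
    (χ : OrthonormalBasis (Fin n) ℂ (LinearMap.range P)) (k : ι) (x : Grassmann ι H) :
    Grassmann ι H :=
  expSeries (circ A χ k) x

end Circle

section Involution

/-- The opposite of an algebra, with the conjugate complex structure. Algebra homomorphisms
`E → ConjOp E` are the antilinear antimultiplicative unital maps `E → E`. -/
def ConjOp (E : Type*) : Type _ := Eᵐᵒᵖ

instance (E : Type*) [Ring E] : Ring (ConjOp E) := inferInstanceAs (Ring Eᵐᵒᵖ)

instance (E : Type*) [Ring E] [Algebra ℂ E] : Algebra ℂ (ConjOp E) :=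
  RingHom.toAlgebra' ((algebraMap ℂ Eᵐᵒᵖ).comp (starRingEnd ℂ))
    (fun c x => Algebra.commutes (A := Eᵐᵒᵖ) (starRingEnd ℂ c) x)

variable {ι H : Type*} [NormedAddCommGroup H] [InnerProductSpace ℂ H]

/-- The map `v ↦ A v` (copy by copy), into the Grassmann algebra with the opposite product and the
conjugate complex structure. -/
def starGen (A : H →ₗ⋆[ℂ] H) : (ι → H) →ₗ[ℂ] ConjOp (Grassmann ι H) where
  toFun v := MulOpposite.op (ExteriorAlgebra.ι ℂ fun q => A (v q))
  map_add' v w := by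
    have h : (fun q => A ((v + w) q)) = (fun q => A (v q)) + fun q => A (w q) := by
      funext q; simp
    rw [h, map_add]; rfl
  map_smul' c v := by
    have h : (fun q => A ((c • v) q)) = (starRingEnd ℂ c) • fun q => A (v q) := by
      funext q; simp
    rw [h, map_smul, RingHom.id_apply, Algebra.smul_def]
    exact (Algebra.smul_def (A := (Grassmann ι H)ᵐᵒᵖ) (starRingEnd ℂ c)
      (MulOpposite.op (ExteriorAlgebra.ι ℂ fun q => A (v q))))

theorem starGen_sq (A : H →ₗ⋆[ℂ] H) (v : ι → H) : starGen A v * starGen A v = 0 :=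
  congrArg MulOpposite.op (ExteriorAlgebra.ι_sq_zero (R := ℂ) fun q => A (v q))

/-- The involution of the Grassmann algebra: the antilinear map with `1* = 1`,
`(ξ ∧ ζ)* = ζ* ∧ ξ*` and `(φ^(q))* = (Aφ)^(q)`. -/
def grassStar (A : H →ₗ⋆[ℂ] H) (ξ : Grassmann ι H) : Grassmann ι H :=
  MulOpposite.unop (α := Grassmann ι H)
    (ExteriorAlgebra.lift ℂ ⟨starGen A, starGen_sq A⟩ ξ)

end Involution

section Weyl

variable {ι H : Type*} [Fintype ι] [DecidableEq ι]
  [NormedAddCommGroup H] [InnerProductSpace ℂ H]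

/-- The vector `(ψ_1^(q), (Aψ_1)^(q), …, ψ_n^(q), (Aψ_n)^(q))`; the entry `(0, j)` is `ψ_j^(q)` and
the entry `(1, j)` is `(Aψ_j)^(q)`. -/
def modes (A : H →ₗ⋆[ℂ] H) {P : H →ₗ[ℂ] H} {n : ℕ}
    (ψ : OrthonormalBasis (Fin n) ℂ (LinearMap.range P)) (q : ι) :
    Fin 2 × Fin n → Grassmann ι H :=
  fun p => ![copy q (ψ p.2 : H), copy q (A (ψ p.2 : H))] p.1

/-- The block diagonal matrix with `n` blocks `(0 1; 1 0)`. -/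
def swapMatrix (ι H : Type*) [NormedAddCommGroup H] [InnerProductSpace ℂ H] (n : ℕ) :
    Matrix (Fin 2 × Fin n) (Fin 2 × Fin n) (Grassmann ι H) :=
  Matrix.blockDiagonal fun _ : Fin n => !![0, 1; 1, 0]

/-- The pairing `(x, 𝒥 y) = xᵀ 𝒥 y`, the entries being multiplied with the exterior product. -/
def pairing {n : ℕ} (x y : Fin 2 × Fin n → Grassmann ι H) : Grassmann ι H :=
  x ⬝ᵥ (swapMatrix ι H n).mulVec y

/-- The Weyl displacement operator `𝕋_k(x) = exp (-(x, 𝒥 ψ^(k)))`, with the exponential of the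
algebra with product `∘_P^(k)`. The basis `χ` enters only in the circle product. -/
def weyl (A : H →ₗ⋆[ℂ] H) {P : H →ₗ[ℂ] H} {n : ℕ}
    (χ ψ : OrthonormalBasis (Fin n) ℂ (LinearMap.range P)) (k : ι)
    (x : Fin 2 × Fin n → Grassmann ι H) : Grassmann ι H :=
  circExp A χ k (-pairing x (modes A ψ k))

end Weyl

end GrassmannWeyl

end

/-!
The linear isomorphism of Chevalley maps the Grassmann algebra onto the Clifford algebra of the
quadratic form `v ↦ ⟨A P v_k, v_k⟩`. The four exponentials in the circle product combine to a
Gaussian in the variables `φ^(a) - φ^(k)`, and integration by parts against it gives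
`v ∘ ξ = v ∧ ξ + ⟨A P v_k, ·⟩ ⌋ ξ` for a vector `v`: the isomorphism turns the circle product into
Clifford multiplication. In the Clifford algebra the nilpotent elements
`W_l = (ψ^(l), 𝒥 ψ^(k))` satisfy `⁅W_l, φ^(k)⁆ = φ^(l)` and `⁅W_l, W_m⁆ = -(ψ^(l), 𝒥 ψ^(m))`.
Both brackets commute with `W_l` and `W_m`, so that the conjugation formula is
`exp x * y * exp (-x) = y + ⁅x, y⁆` and the product formula is the Baker-Campbell-Hausdorff formula
`exp (x + y) = exp x * exp y * exp (-⁅x, y⁆ / 2)`.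
-/

noncomputable section

namespace GrassmannWeyl

section NilpotentExponential

open IsNilpotent Polynomial

variable {A : Type*} [Ring A]

theorem map_pow_succ_of_leibniz {D : A →+ A} {x b : A} (hD : ∀ z, D (x * z) = b * z + x * D z)
    (hD1 : D 1 = 0) (hxb : Commute x b) (r : ℕ) : D (x ^ (r + 1)) = (r + 1) • (b * x ^ r) := by
  induction r with
  | zero => simpa [hD1] using hD 1
  | succ r ih =>
    rw [pow_succ' x (r + 1), hD, ih, mul_smul_comm, ← mul_assoc, hxb.eq, mul_assoc, ← pow_succ',
      succ_nsmul' _ (r + 1)]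

theorem commute_monomial {u v : A} (huv : Commute u v) (i j : ℕ) :
    Commute (monomial i u : A[X]) (monomial j v) := by
  rw [Commute, SemiconjBy, monomial_mul_monomial, monomial_mul_monomial, huv.eq, add_comm]

/-- Evaluation at `1` of polynomials with coefficients in a not necessarily commutative ring. -/
def evalOne : A[X] →+* A := eval₂RingHom' (RingHom.id A) 1 fun a => Commute.one_right a

variable [Module ℚ A]

theorem map_exp_of_leibniz {D : A →+ A} {x b : A} (hx : IsNilpotent x)
    (hD : ∀ z, D (x * z) = b * z + x * D z) (hD1 : D 1 = 0) (hxb : Commute x b) :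
    D (exp x) = b * exp x := by
  obtain ⟨N, hN⟩ := hx
  rw [exp_eq_sum hN, Finset.mul_sum, ← exp_eq_sum hN, exp_eq_sum (pow_eq_zero_of_le N.le_succ hN),
    Finset.sum_range_succ', map_add, map_sum, map_rat_smul D, pow_zero, hD1, smul_zero, add_zero]
  refine Finset.sum_congr rfl fun r _ => ?_
  have hr : ((r + 1).factorial : ℚ)⁻¹ * ((r + 1 : ℕ) : ℚ) = (r.factorial : ℚ)⁻¹ := by
    rw [Nat.factorial_succ]
    push_cast
    field_simp
  rw [map_rat_smul D, map_pow_succ_of_leibniz hD hD1 hxb, ← Nat.cast_smul_eq_nsmul ℚ, smul_smul,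
    hr, mul_smul_comm]

theorem exp_mul_of_commute_lie {x y : A} (hx : IsNilpotent x) (hxy : Commute x ⁅x, y⁆) :
    exp x * y = (y + ⁅x, y⁆) * exp x := by
  have h := map_exp_of_leibniz (D := AddMonoidHom.mulRight y - AddMonoidHom.mulLeft y) hx
    (fun z => by
      simp only [AddMonoidHom.sub_apply, AddMonoidHom.coe_mulRight, AddMonoidHom.coe_mulLeft,
        Ring.lie_def]
      noncomm_ring) (by simp) hxy
  rw [add_mul]
  exact sub_eq_iff_eq_add'.1 h

theorem exp_mul_mul_exp_neg {x y : A} (hx : IsNilpotent x) (hxy : Commute x ⁅x, y⁆) :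
    exp x * y * exp (-x) = y + ⁅x, y⁆ := by
  rw [exp_mul_of_commute_lie hx hxy, mul_assoc, exp_mul_exp_neg_self hx, mul_one]

theorem coeff_of_derivative_eq_C_mul {F : A[X]} {s : A} (hF : derivative F = C s * F)
    (h0 : F.coeff 0 = 1) (r : ℕ) : F.coeff r = (r.factorial : ℚ)⁻¹ • s ^ r := by
  induction r with
  | zero => simp [h0]
  | succ r ih =>
    have h : ((r + 1 : ℕ) : ℚ) • F.coeff (r + 1) = s * F.coeff r := by
      rw [← coeff_C_mul, ← hF, coeff_derivative, Nat.cast_smul_eq_nsmul, nsmul_eq_mul',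
        Nat.cast_succ]
    rw [Nat.factorial_succ, Nat.cast_mul, mul_inv, mul_smul, pow_succ', ← mul_smul_comm, ← ih, ← h,
      smul_smul, inv_mul_cancel₀ (by positivity), one_smul]

theorem isNilpotent_and_evalOne_eq_exp {F : A[X]} {s : A} (hF : derivative F = C s * F)
    (h0 : F.coeff 0 = 1) : IsNilpotent s ∧ evalOne F = exp s := by
  have hs : s ^ (F.natDegree + 1) = 0 := by
    have h := coeff_of_derivative_eq_C_mul hF h0 (F.natDegree + 1)
    rw [coeff_eq_zero_of_natDegree_lt (Nat.lt_succ_self _)] at h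
    exact (smul_eq_zero.1 h.symm).resolve_left (by positivity)
  refine ⟨⟨_, hs⟩, ?_⟩
  rw [exp_eq_sum hs]
  change F.eval 1 = _
  rw [eval_eq_sum_range]
  simp only [one_pow, mul_one, coeff_of_derivative_eq_C_mul hF h0]

theorem commute_exp_of_commute {x y : A} (hx : IsNilpotent x) (hxy : Commute x y) :
    Commute (exp x) y := by
  have h := exp_mul_of_commute_lie hx (y := y) (by rw [hxy.lie_eq]; exact Commute.zero_right x)
  rwa [hxy.lie_eq, add_zero] at h

theorem derivative_exp_monomial {u : A} (hu : IsNilpotent u) (r : ℕ) :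
    derivative (exp (monomial (r + 1) u : A[X])) =
      monomial r ((r + 1) • u) * exp (monomial (r + 1) u) := by
  have hderiv : derivative (monomial (r + 1) u : A[X]) = monomial r ((r + 1) • u) := by
    rw [derivative_monomial, nsmul_eq_mul', Nat.add_sub_cancel]
  have hcomm : Commute u ((r + 1) • u) := (Commute.refl u).smul_right _
  exact map_exp_of_leibniz (D := derivative.toAddMonoidHom) (isNilpotent_monomial_iff.2 hu)
    (fun z => by rw [← hderiv]; exact derivative_mul) derivative_one (commute_monomial hcomm _ _)

theorem coeff_zero_exp_monomial {u : A} (hu : IsNilpotent u) (r : ℕ) :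
    (exp (monomial (r + 1) u : A[X])).coeff 0 = 1 := by
  have h := map_exp (isNilpotent_monomial_iff.2 hu) (constantCoeff : A[X] →+* A)
    (a := monomial (r + 1) u)
  rw [constantCoeff_apply, constantCoeff_apply, coeff_monomial_of_ne _ r.succ_ne_zero.symm,
    exp_zero] at h
  exact h

theorem evalOne_exp_monomial {u : A} (hu : IsNilpotent u) (r : ℕ) :
    evalOne (exp (monomial r u : A[X])) = exp u := by
  rw [map_exp (isNilpotent_monomial_iff.2 hu)]
  simp [evalOne]

theorem commute_exp_monomial {u v : A} (hu : IsNilpotent u) (huv : Commute u v) (i j : ℕ) :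
    Commute (exp (monomial i u : A[X])) (monomial j v) :=
  commute_exp_of_commute (isNilpotent_monomial_iff.2 hu) (commute_monomial huv i j)

theorem exp_monomial_mul_C {x y : A} (hx : IsNilpotent x) (hxy : Commute x ⁅x, y⁆) :
    exp (monomial 1 x : A[X]) * C y = (C y + monomial 1 ⁅x, y⁆) * exp (monomial 1 x) := by
  have hlie : ⁅(monomial 1 x : A[X]), C y⁆ = monomial 1 ⁅x, y⁆ := by
    rw [Ring.lie_def, monomial_mul_C, C_mul_monomial, ← map_sub, ← Ring.lie_def]
  rw [← hlie]
  refine exp_mul_of_commute_lie (isNilpotent_monomial_iff.2 hx) ?_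
  rw [hlie]
  exact commute_monomial hxy 1 1

theorem isNilpotent_add_and_exp_add {x y : A} (hx : IsNilpotent x) (hy : IsNilpotent y)
    (hc : IsNilpotent ⁅x, y⁆) (hxc : Commute x ⁅x, y⁆) (hyc : Commute y ⁅x, y⁆) :
    IsNilpotent (x + y) ∧ exp (x + y) = exp x * exp y * exp (-(1 / 2 : ℚ) • ⁅x, y⁆) := by
  -- With `x`, `y` replaced by `tx`, `ty`, the right-hand side is a polynomial in `t` that solves
  -- `dF/dt = (x + y) F`, which determines its coefficients and bounds the powers of `x + y`.
  set c := ⁅x, y⁆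
  set z := -(1 / 2 : ℚ) • c with hzdef
  have hz : IsNilpotent z := hc.smul _
  set ex : A[X] := exp (monomial 1 x)
  set ey : A[X] := exp (monomial 1 y)
  set ez : A[X] := exp (monomial 2 z)
  have hex : derivative ex = C x * ex := by simpa using derivative_exp_monomial hx 0
  have hey : derivative ey = C y * ey := by simpa using derivative_exp_monomial hy 0
  have hez : derivative ez = -monomial 1 c * ez := by
    have h2 : (1 + 1) • z = -c := by
      rw [hzdef, ← Nat.cast_smul_eq_nsmul ℚ, smul_smul]
      norm_num
    rw [derivative_exp_monomial hz 1, h2, map_neg]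
  have hcomm : Commute (ex * ey) (monomial 1 c) :=
    (commute_exp_monomial hx hxc 1 1).mul_left (commute_exp_monomial hy hyc 1 1)
  have hderiv : derivative (ex * ey * ez) = C (x + y) * (ex * ey * ez) := by
    calc derivative (ex * ey * ez)
        = C x * (ex * ey * ez) + (ex * C y) * (ey * ez) - (ex * ey * monomial 1 c) * ez := by
          rw [derivative_mul, derivative_mul, hex, hey, hez]
          noncomm_ring
      _ = C (x + y) * (ex * ey * ez) := by
          rw [exp_monomial_mul_C hx hxc, hcomm.eq, C_add]
          noncomm_ring
  have h0 : (ex * ey * ez).coeff 0 = 1 := by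
    rw [mul_coeff_zero, mul_coeff_zero, coeff_zero_exp_monomial hx 0, coeff_zero_exp_monomial hy 0,
      coeff_zero_exp_monomial hz 1, one_mul, one_mul]
  obtain ⟨hs, hexp⟩ := isNilpotent_and_evalOne_eq_exp hderiv h0
  refine ⟨hs, ?_⟩
  rw [← hexp, map_mul, map_mul, evalOne_exp_monomial hx, evalOne_exp_monomial hy,
    evalOne_exp_monomial hz]

theorem isNilpotent_sum_of_commute_lie {κ : Type*} {f : κ → A} (s : Finset κ)
    (hf : ∀ i, IsNilpotent (f i)) (hlie : ∀ i j, IsNilpotent ⁅f i, f j⁆)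
    (hcomm : ∀ l i j, Commute (f l) ⁅f i, f j⁆) : IsNilpotent (∑ i ∈ s, f i) := by
  classical
  have lie_sum : ∀ (i : κ) (t : Finset κ), ⁅f i, ∑ j ∈ t, f j⁆ = ∑ j ∈ t, ⁅f i, f j⁆ :=
    fun i t => by simp only [Ring.lie_def, Finset.mul_sum, Finset.sum_mul, Finset.sum_sub_distrib]
  have hcomm_sum : ∀ (l : κ) (i : κ) (t : Finset κ), Commute (f l) ⁅f i, ∑ j ∈ t, f j⁆ :=
    fun l i t => lie_sum i t ▸ Commute.sum_right _ _ _ fun j _ => hcomm l i j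
  have hlie_comm : ∀ i j l m, Commute ⁅f i, f j⁆ ⁅f l, f m⁆ := fun i j l m => by
    rw [Ring.lie_def (f i)]
    exact ((hcomm i l m).mul_left (hcomm j l m)).sub_left ((hcomm j l m).mul_left (hcomm i l m))
  induction s using Finset.induction_on with
  | empty => simp
  | insert a t ha ih =>
    rw [Finset.sum_insert ha]
    refine (isNilpotent_add_and_exp_add (hf a) ih ?_ (hcomm_sum a a t)
      (Commute.sum_left _ _ _ fun l _ => hcomm_sum l a t)).1
    rw [lie_sum]
    exact Commute.isNilpotent_sum (fun j _ => hlie a j) fun i j _ _ => hlie_comm a i a j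

end NilpotentExponential

section Contraction

open CliffordAlgebra

variable {R M : Type*} [CommRing R] [AddCommGroup M] [Module R M] {Q : QuadraticForm R M}

theorem involute_contractLeft (d : Module.Dual R M) (x : CliffordAlgebra Q) :
    involute (contractLeft d x) = -contractLeft d (involute x) := by
  induction x using CliffordAlgebra.left_induction with
  | algebraMap r => simp
  | add x y hx hy => simp only [map_add, hx, hy, neg_add]
  | ι_mul x v hx =>
    simp only [contractLeft_ι_mul, map_sub, map_mul, involute_ι, map_smul, hx, neg_mul, map_neg]
    noncomm_ring

theorem contractLeft_mul (d : Module.Dual R M) (x y : CliffordAlgebra Q) :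
    contractLeft d (x * y) = contractLeft d x * y + involute x * contractLeft d y := by
  induction x using CliffordAlgebra.left_induction with
  | algebraMap r => simp [contractLeft_algebraMap_mul]
  | add x x' hx hx' => simp only [add_mul, map_add, hx, hx']; abel
  | ι_mul x v hx =>
    simp only [mul_assoc, contractLeft_ι_mul, hx, map_mul, involute_ι, sub_mul, mul_add, neg_mul,
      smul_mul_assoc]
    abel

end Contraction

section ExteriorAlgebra

open CliffordAlgebra (contractLeft contractLeft_ι contractLeft_ι_mul contractLeft_one
  contractLeft_comm contractLeft_contractLeft involute involute_ι involute_involute)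
open ExteriorAlgebra IsNilpotent

variable {R M N : Type*} [CommRing R] [AddCommGroup M] [Module R M] [AddCommGroup N] [Module R N]

theorem ι_mul_eq_involute_mul (v : M) (x : ExteriorAlgebra R M) :
    ι R v * x = involute x * ι R v := by
  induction x using CliffordAlgebra.left_induction with
  | algebraMap r => simpa using (Algebra.commutes r (ι R v)).symm
  | add x x' hx hx' => simp only [add_mul, mul_add, map_add, hx, hx']
  | ι_mul x w hx =>
    have hswap : ι R v * ι R w = -ι R w * ι R v := by
      rw [neg_mul, eq_neg_iff_add_eq_zero, ι_add_mul_swap]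
    rw [map_mul, involute_ι, mul_assoc, ← hx, ← mul_assoc, ← mul_assoc, hswap]

theorem commute_ι_mul_ι (v w : M) (x : ExteriorAlgebra R M) : Commute (ι R v * ι R w) x := by
  rw [Commute, SemiconjBy, mul_assoc, ι_mul_eq_involute_mul w, ← mul_assoc,
    ι_mul_eq_involute_mul v, involute_involute, mul_assoc]

theorem ι_mul_ι_sq (v w : M) : (ι R v * ι R w) ^ 2 = 0 := by
  rw [sq, ← mul_assoc, (commute_ι_mul_ι v w (ι R v)).eq, ← mul_assoc, ι_sq_zero, zero_mul, zero_mul]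

theorem contractLeft_map (f : M →ₗ[R] N) (d : Module.Dual R N) (x : ExteriorAlgebra R M) :
    contractLeft d (map f x) = map f (contractLeft (d ∘ₗ f) x) := by
  induction x using CliffordAlgebra.left_induction with
  | algebraMap r => simp
  | add x x' hx hx' => simp only [map_add, hx, hx']
  | ι_mul x v hx =>
    rw [map_mul, map_apply_ι, contractLeft_ι_mul, contractLeft_ι_mul, hx, map_sub, map_smul,
      map_mul, map_apply_ι, LinearMap.comp_apply]

theorem involute_map (f : M →ₗ[R] N) (x : ExteriorAlgebra R M) :
    involute (map f x) = map f (involute x) := by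
  induction x using CliffordAlgebra.left_induction with
  | algebraMap r => simp
  | add x x' hx hx' => simp only [map_add, hx, hx']
  | ι_mul x v hx =>
    simp only [map_mul, map_apply_ι, involute_ι, map_neg, hx]

section Gaussian

variable {κ : Type*} (f g : κ → Module.Dual R M) (a b : κ → M)

/-- The Berezin integral `∏ (f_j ⌋) (g_j ⌋)` over a list of pairs of functionals. -/
def iteratedContraction (l : List κ) : Module.End R (ExteriorAlgebra R M) :=
  (l.map fun j => contractLeft (f j) * contractLeft (g j)).prod

/-- The sum `∑ b_j ∧ a_j`, the exponent of a fermionic Gaussian. -/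
def bivectorSum (l : List κ) : ExteriorAlgebra R M :=
  (l.map fun j => ι R (b j) * ι R (a j)).sum

variable {f g a b}

theorem iteratedContraction_cons (j : κ) (l : List κ) (x : ExteriorAlgebra R M) :
    iteratedContraction f g (j :: l) x =
      contractLeft (f j) (contractLeft (g j) (iteratedContraction f g l x)) :=
  rfl

theorem iteratedContraction_contractLeft (l : List κ) (d : Module.Dual R M)
    (x : ExteriorAlgebra R M) :
    iteratedContraction f g l (contractLeft d x) =
      contractLeft d (iteratedContraction f g l x) := by
  induction l with
  | nil => rfl
  | cons j l ih =>
    rw [iteratedContraction_cons, ih, contractLeft_comm (g j), map_neg, contractLeft_comm (f j),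
      neg_neg, iteratedContraction_cons]

theorem iteratedContraction_ι_mul {s : M} (hf : ∀ j, f j s = 0) (hg : ∀ j, g j s = 0)
    (l : List κ) (x : ExteriorAlgebra R M) :
    iteratedContraction f g l (ι R s * x) = ι R s * iteratedContraction f g l x := by
  induction l with
  | nil => rfl
  | cons j l ih =>
    rw [iteratedContraction_cons, ih, contractLeft_ι_mul, hg, zero_smul, zero_sub, map_neg,
      contractLeft_ι_mul, hf, zero_smul, zero_sub, neg_neg, iteratedContraction_cons]

theorem iteratedContraction_contractLeft_of_mem {i : κ} {l : List κ} (hi : i ∈ l)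
    (x : ExteriorAlgebra R M) :
    iteratedContraction f g l (contractLeft (f i) x) = 0 ∧
      iteratedContraction f g l (contractLeft (g i) x) = 0 := by
  induction l with
  | nil => simp at hi
  | cons j l ih =>
    rw [iteratedContraction_cons, iteratedContraction_cons]
    rcases List.mem_cons.1 hi with rfl | hi
    · rw [iteratedContraction_contractLeft, iteratedContraction_contractLeft,
        contractLeft_contractLeft, contractLeft_comm, contractLeft_contractLeft]
      simp only [map_zero, neg_zero, and_self]
    · rw [(ih hi).1, (ih hi).2]
      simp only [map_zero, and_self]

theorem bivectorSum_cons (j : κ) (l : List κ) :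
    bivectorSum (R := R) a b (j :: l) = ι R (b j) * ι R (a j) + bivectorSum a b l := by
  simp [bivectorSum]

theorem commute_bivectorSum (l : List κ) (x : ExteriorAlgebra R M) :
    Commute (bivectorSum a b l) x := by
  refine Commute.list_sum_left _ _ fun c hc => ?_
  obtain ⟨j, -, rfl⟩ := List.mem_map.1 hc
  exact commute_ι_mul_ι _ _ _

theorem isNilpotent_bivectorSum (l : List κ) : IsNilpotent (bivectorSum (R := R) a b l) := by
  induction l with
  | nil => exact IsNilpotent.zero
  | cons j l ih =>
    rw [bivectorSum_cons]
    exact (commute_ι_mul_ι _ _ _).isNilpotent_add ⟨2, ι_mul_ι_sq _ _⟩ ih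

theorem involute_bivectorSum (l : List κ) :
    involute (bivectorSum (R := R) a b l) = bivectorSum a b l := by
  induction l with
  | nil => exact map_zero _
  | cons j l ih => simp [bivectorSum_cons, ih]

theorem contractLeft_bivectorSum (d : Module.Dual R M) (l : List κ) :
    contractLeft d (bivectorSum a b l) =
      ι R (l.map fun j => d (b j) • a j - d (a j) • b j).sum := by
  induction l with
  | nil => simp [bivectorSum]
  | cons j l ih =>
    rw [bivectorSum_cons, map_add, ih, contractLeft_ι_mul, contractLeft_ι, List.map_cons,
      List.sum_cons, map_add, map_sub, map_smul, map_smul, ← Algebra.commutes,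
      Algebra.smul_def (d (a j))]

variable [Module ℚ (ExteriorAlgebra R M)]

theorem contractLeft_exp_neg_bivectorSum (d : Module.Dual R M) (l : List κ) :
    contractLeft d (exp (-bivectorSum a b l)) =
      -contractLeft d (bivectorSum a b l) * exp (-bivectorSum a b l) :=
  map_exp_of_leibniz (D := (contractLeft d).toAddMonoidHom) (isNilpotent_bivectorSum l).neg
    (fun z => by
      change contractLeft d _ = _
      rw [contractLeft_mul, map_neg, map_neg, involute_bivectorSum]; rfl)
    (contractLeft_one _ d) (commute_bivectorSum l _).neg_left

theorem exp_neg_bivectorSum_cons (j : κ) (l : List κ) :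
    exp (-bivectorSum (R := R) a b (j :: l)) =
      exp (-bivectorSum a b l) - ι R (b j) * (ι R (a j) * exp (-bivectorSum a b l)) := by
  have hsq : (-(ι R (b j) * ι R (a j))) ^ 2 = 0 := by rw [neg_sq, ι_mul_ι_sq]
  have hcomm : Commute (-(ι R (b j) * ι R (a j))) (-bivectorSum (R := R) a b l) :=
    (commute_ι_mul_ι _ _ _).neg_left
  rw [bivectorSum_cons, neg_add, exp_add_of_commute hcomm ⟨2, hsq⟩
    (isNilpotent_bivectorSum l).neg, exp_eq_sum hsq, Finset.sum_range_succ, Finset.sum_range_one]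
  simp [add_mul, mul_assoc, sub_eq_add_neg]

theorem integral_ι_mul_mul_gaussian {I : ExteriorAlgebra R M →ₗ[R] N} {d : Module.Dual R M}
    (hI : ∀ x, I (contractLeft d x) = 0) {l : List κ} {v : M}
    (hv : contractLeft d (bivectorSum a b l) = ι R v) (x : ExteriorAlgebra R M) :
    I (ι R v * x * exp (-bivectorSum a b l)) =
      I (contractLeft d x * exp (-bivectorSum a b l)) := by
  -- Integration by parts: the integral of the contraction of `x` times the Gaussian vanishes.
  have h := hI (x * exp (-bivectorSum a b l))
  rw [contractLeft_mul, contractLeft_exp_neg_bivectorSum, hv, neg_mul, mul_neg, ← mul_assoc,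
    ← ι_mul_eq_involute_mul, map_add, map_neg, add_neg_eq_zero] at h
  exact h.symm

theorem iteratedContraction_gaussian [DecidableEq κ]
    (hfa : ∀ i j, f i (a j) = if i = j then 1 else 0)
    (hfb : ∀ i j, f i (b j) = 0) (hga : ∀ i j, g i (a j) = 0)
    (hgb : ∀ i j, g i (b j) = if i = j then 1 else 0) {l : List κ} (hl : l.Nodup) :
    iteratedContraction f g l (exp (-bivectorSum a b l)) = (-1) ^ l.length := by
  induction l with
  | nil => simp [iteratedContraction, bivectorSum]
  | cons j l ih =>
    obtain ⟨hj, hl⟩ := List.nodup_cons.1 hl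
    set G := exp (-bivectorSum (R := R) a b l) with hG
    have hne : ∀ i ∈ l, j ≠ i := fun i hi h => hj (h ▸ hi)
    have hfG : contractLeft (f j) G = 0 := by
      rw [contractLeft_exp_neg_bivectorSum, contractLeft_bivectorSum, List.sum_eq_zero (by
        simpa using fun i hi => by simp [hfa, hfb, hne i hi])]
      simp
    have hgG : contractLeft (g j) G = 0 := by
      rw [contractLeft_exp_neg_bivectorSum, contractLeft_bivectorSum, List.sum_eq_zero (by
        simpa using fun i hi => by simp [hga, hgb, hne i hi])]
      simp
    have hpair : contractLeft (f j) (contractLeft (g j) (exp (-bivectorSum a b (j :: l)))) =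
        -G := by
      rw [exp_neg_bivectorSum_cons, ← hG, map_sub, hgG]
      simp [contractLeft_ι_mul, hfa, hga, hgb, hfG, hgG]
    rw [iteratedContraction_cons, ← iteratedContraction_contractLeft,
      ← iteratedContraction_contractLeft, hpair, map_neg, ih hl, List.length_cons, _root_.pow_succ,
      mul_neg_one]

end Gaussian

end ExteriorAlgebra

section ToClifford

open CliffordAlgebra

theorem clifford_ι_mul {R M : Type*} [CommRing R] [AddCommGroup M] [Module R M]
    {Q : QuadraticForm R M} (v : M) (x : CliffordAlgebra Q) :
    ι Q v * x = involute x * ι Q v + contractLeft (QuadraticMap.polarBilin Q v) x := by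
  induction x using CliffordAlgebra.left_induction with
  | algebraMap r => simp [Algebra.commutes]
  | add x y hx hy => simp only [mul_add, add_mul, map_add, hx, hy]; abel
  | ι_mul x w hx =>
    have hswap : ι Q v * ι Q w =
        algebraMap R _ (QuadraticMap.polarBilin Q v w) - ι Q w * ι Q v :=
      eq_sub_of_add_eq (ι_mul_ι_add_swap v w)
    rw [← mul_assoc, hswap, sub_mul, mul_assoc (ι Q w), hx, map_mul, involute_ι, contractLeft_ι_mul,
      ← Algebra.smul_def]
    noncomm_ring

variable {R M : Type*} [CommRing R] [AddCommGroup M] [Module R M] (B : LinearMap.BilinForm R M)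

/-- The linear isomorphism of Chevalley from the exterior algebra to the Clifford algebra of the
quadratic form `v ↦ B v v`. -/
def toClifford : ExteriorAlgebra R M ≃ₗ[R] CliffordAlgebra B.toQuadraticMap :=
  changeFormEquiv (B := B) (sub_zero B.toQuadraticMap).symm

theorem toClifford_one : toClifford B 1 = 1 :=
  changeForm_one (sub_zero B.toQuadraticMap).symm

theorem toClifford_ι (v : M) : toClifford B (ExteriorAlgebra.ι R v) = ι B.toQuadraticMap v :=
  changeForm_ι (sub_zero B.toQuadraticMap).symm v

theorem toClifford_ι_mul (v : M) (x : ExteriorAlgebra R M) :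
    toClifford B (ExteriorAlgebra.ι R v * x) =
      ι B.toQuadraticMap v * toClifford B x - contractLeft (B v) (toClifford B x) :=
  changeForm_ι_mul (sub_zero B.toQuadraticMap).symm v x

theorem toClifford_contractLeft (d : Module.Dual R M) (x : ExteriorAlgebra R M) :
    toClifford B (contractLeft d x) = contractLeft d (toClifford B x) :=
  changeForm_contractLeft (sub_zero B.toQuadraticMap).symm d x

theorem involute_ι_mul (v : M) (x : ExteriorAlgebra R M) :
    involute (ExteriorAlgebra.ι R v * x) = -(ExteriorAlgebra.ι R v * involute x) := by
  rw [map_mul, ← neg_mul]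
  exact congrArg (· * _) (involute_ι v)

theorem toClifford_involute (x : ExteriorAlgebra R M) :
    toClifford B (involute x) = involute (toClifford B x) := by
  induction x using CliffordAlgebra.left_induction with
  | algebraMap r => simp [Algebra.algebraMap_eq_smul_one, toClifford_one]
  | add x y hx hy => simp only [map_add, hx, hy]
  | ι_mul x v hx =>
    change toClifford B (involute (ExteriorAlgebra.ι R v * x)) =
      involute (toClifford B (ExteriorAlgebra.ι R v * x))
    rw [involute_ι_mul, map_neg, toClifford_ι_mul, toClifford_ι_mul, hx, map_sub, map_mul,
      involute_ι, involute_contractLeft]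
    noncomm_ring

theorem toClifford_mul_ι (x : ExteriorAlgebra R M) (v : M) :
    toClifford B (x * ExteriorAlgebra.ι R v) =
      toClifford B x * ι B.toQuadraticMap v +
        contractLeft (B.flip v) (toClifford B (involute x)) := by
  have hpolar : QuadraticMap.polarBilin B.toQuadraticMap v = B v + B.flip v := by
    ext w
    simp [LinearMap.BilinMap.polar_toQuadraticMap]
  have hx : x * ExteriorAlgebra.ι R v = ExteriorAlgebra.ι R v * involute x := by
    rw [ι_mul_eq_involute_mul, involute_involute]
  rw [hx, toClifford_ι_mul, clifford_ι_mul, ← toClifford_involute, involute_involute,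
    hpolar, map_add, LinearMap.add_apply]
  abel

theorem toClifford_eq_mul
    {b : ExteriorAlgebra R M →ₗ[R] ExteriorAlgebra R M →ₗ[R] ExteriorAlgebra R M}
    (hone : ∀ ζ, b 1 ζ = ζ)
    (hι : ∀ v ξ ζ, b (ExteriorAlgebra.ι R v * ξ) ζ =
      ExteriorAlgebra.ι R v * b ξ ζ + b (involute ξ) (contractLeft (B v) ζ))
    (ξ ζ : ExteriorAlgebra R M) :
    toClifford B (b ξ ζ) = toClifford B ξ * toClifford B ζ := by
  have ι_mul_left : ∀ v η, (∀ ζ, toClifford B (b η ζ) = toClifford B η * toClifford B ζ) →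
      (∀ ζ, toClifford B (b (involute η) ζ) = toClifford B (involute η) * toClifford B ζ) →
      ∀ ζ, toClifford B (b (ExteriorAlgebra.ι R v * η) ζ) =
        toClifford B (ExteriorAlgebra.ι R v * η) * toClifford B ζ := fun v η h h' ζ => by
    rw [hι, map_add, toClifford_ι_mul, h, h', toClifford_ι_mul, toClifford_contractLeft,
      toClifford_involute, contractLeft_mul]
    noncomm_ring
  suffices h : (∀ ζ, toClifford B (b ξ ζ) = toClifford B ξ * toClifford B ζ) ∧
      ∀ ζ, toClifford B (b (involute ξ) ζ) = toClifford B (involute ξ) * toClifford B ζ from h.1 ζ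
  induction ξ using CliffordAlgebra.left_induction with
  | algebraMap r =>
    have h : ∀ ζ, toClifford B (b (algebraMap R _ r) ζ) =
        toClifford B (algebraMap R _ r) * toClifford B ζ := fun ζ => by
      simp [Algebra.algebraMap_eq_smul_one, toClifford_one, hone]
    rw [AlgHom.commutes]
    exact ⟨h, h⟩
  | add x y hx hy =>
    simp only [map_add, LinearMap.add_apply, add_mul, hx.1, hx.2, hy.1, hy.2, implies_true,
      and_self]
  | ι_mul x v hx =>
    refine ⟨ι_mul_left v x hx.1 hx.2, fun ζ => ?_⟩
    change toClifford B (b (involute (ExteriorAlgebra.ι R v * x)) ζ) =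
      toClifford B (involute (ExteriorAlgebra.ι R v * x)) * _
    rw [involute_ι_mul, map_neg, LinearMap.neg_apply, map_neg, map_neg, neg_mul,
      ι_mul_left v _ hx.2 (by simpa only [involute_involute] using hx.1)]

end ToClifford

section BasisProjection

variable {H : Type*} [NormedAddCommGroup H] [InnerProductSpace ℂ H] {A : H →ₗ⋆[ℂ] H}
  {P : H →ₗ[ℂ] H} {n : ℕ}

theorem IsSelfDual.inner_left (hA : IsSelfDual A) (x y : H) :
    inner ℂ (A x) y = inner ℂ (A y) x := by
  rw [← hA.inner_map x, hA.involutive]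

theorem IsSelfDual.inner_right (hA : IsSelfDual A) (x y : H) :
    inner ℂ x (A y) = inner ℂ y (A x) := by
  rw [← inner_conj_symm, hA.inner_left, inner_conj_symm]

theorem IsBasisProjection.map_map (hP : IsBasisProjection A P) (x : H) : P (P x) = P x :=
  LinearMap.congr_fun hP.isSymmetricProjection.isIdempotentElem.eq x

theorem IsBasisProjection.apply_of_mem_range (hP : IsBasisProjection A P)
    (x : LinearMap.range P) : P x = x := by
  obtain ⟨_, y, rfl⟩ := x
  exact hP.map_map y

theorem IsBasisProjection.conj_map (hA : IsSelfDual A) (hP : IsBasisProjection A P) (x : H) :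
    A (P x) = A x - P (A x) := by
  rw [← hP.conj_eq, hA.involutive]

theorem IsBasisProjection.map_conj (hA : IsSelfDual A) (hP : IsBasisProjection A P) (x : H) :
    P (A x) = A x - A (P x) := by
  rw [hP.conj_map hA, sub_sub_cancel]

variable (χ : OrthonormalBasis (Fin n) ℂ (LinearMap.range P))

theorem IsBasisProjection.sum_inner_smul (hP : IsBasisProjection A P) (x : H) :
    ∑ j, inner ℂ (χ j : H) x • (χ j : H) = P x := by
  have h : ((∑ j, inner ℂ (χ j) ⟨P x, x, rfl⟩ • χ j : LinearMap.range P) : H) = P x :=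
    congrArg Subtype.val (χ.sum_repr' ⟨P x, x, rfl⟩)
  rw [← h, AddSubmonoidClass.coe_finsetSum]
  refine Finset.sum_congr rfl fun j _ => ?_
  rw [Submodule.coe_smul, Submodule.coe_inner, ← hP.isSymmetricProjection.isSymmetric,
    hP.apply_of_mem_range]

theorem IsBasisProjection.sum_inner_conj_smul (hA : IsSelfDual A) (hP : IsBasisProjection A P)
    (x : H) : ∑ j, inner ℂ (A (χ j)) x • A (χ j) = x - P x := by
  rw [← hP.conj_eq, ← hP.sum_inner_smul χ, map_sum]
  refine Finset.sum_congr rfl fun j _ => ?_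
  rw [LinearMap.map_smulₛₗ, inner_conj_symm, hA.inner_left, hA.inner_left]

/-- The vectors `ψ_1, Aψ_1, …, ψ_n, Aψ_n`, with the indexing of `modes`. -/
def modeVector (A : H →ₗ⋆[ℂ] H) (ψ : OrthonormalBasis (Fin n) ℂ (LinearMap.range P))
    (p : Fin 2 × Fin n) : H :=
  ![(ψ p.2 : H), A (ψ p.2)] p.1

theorem sum_inner_smul_modeVector (hA : IsSelfDual A) (hP : IsBasisProjection A P) (x : H) :
    ∑ p, inner ℂ (modeVector A χ p) x • modeVector A χ p = x := by
  rw [Fintype.sum_prod_type, Fin.sum_univ_two]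
  change ∑ j, inner ℂ (χ j : H) x • (χ j : H) + ∑ j, inner ℂ (A (χ j)) x • A (χ j) = x
  rw [hP.sum_inner_smul, hP.sum_inner_conj_smul χ hA, add_sub_cancel]

theorem inner_coe (i j : Fin n) : inner ℂ (χ i : H) (χ j) = if i = j then 1 else 0 :=
  orthonormal_iff_ite.1 χ.orthonormal i j

theorem inner_conj_conj (hA : IsSelfDual A) (i j : Fin n) :
    inner ℂ (A (χ i)) (A (χ j)) = if i = j then 1 else 0 := by
  simp [hA.inner_map, inner_coe, eq_comm]

theorem inner_coe_conj (hA : IsSelfDual A) (hP : IsBasisProjection A P) (i j : Fin n) :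
    inner ℂ (χ i : H) (A (χ j)) = 0 := by
  rw [← hP.apply_of_mem_range, hP.isSymmetricProjection.isSymmetric, hP.map_conj hA,
    hP.apply_of_mem_range, sub_self, inner_zero_right]

theorem inner_conj_coe (hA : IsSelfDual A) (hP : IsBasisProjection A P) (i j : Fin n) :
    inner ℂ (A (χ i)) (χ j : H) = 0 := by
  rw [← inner_conj_symm, inner_coe_conj χ hA hP, map_zero]

theorem orthonormal_modeVector (hA : IsSelfDual A) (hP : IsBasisProjection A P) :
    Orthonormal ℂ (modeVector A χ) := by
  rw [orthonormal_iff_ite]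
  rintro ⟨a, i⟩ ⟨b, j⟩
  fin_cases a <;> fin_cases b <;>
    simp [modeVector, inner_coe, inner_conj_conj χ hA, inner_coe_conj χ hA hP,
      inner_conj_coe χ hA hP]

theorem finrank_eq_two_mul (χ : OrthonormalBasis (Fin n) ℂ (LinearMap.range P))
    (hA : IsSelfDual A) (hP : IsBasisProjection A P) : Module.finrank ℂ H = 2 * n := by
  have hspan : ⊤ ≤ Submodule.span ℂ (Set.range (modeVector A χ)) := fun x _ => by
    rw [← sum_inner_smul_modeVector χ hA hP x]
    exact Submodule.sum_mem _ fun p _ =>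
      Submodule.smul_mem _ _ (Submodule.subset_span (Set.mem_range_self p))
  let b := Module.Basis.mk (orthonormal_modeVector χ hA hP).linearIndependent hspan
  rw [Module.finrank_eq_card_basis b, Fintype.card_prod, Fintype.card_fin, Fintype.card_fin]

end BasisProjection

instance cliffordAlgebraRatModule {V : Type*} [AddCommGroup V] [Module ℂ V]
    (Q : QuadraticForm ℂ V) : Module ℚ (CliffordAlgebra Q) :=
  Module.compHom _ (algebraMap ℚ ℂ)

section GaussianIntegral

open CliffordAlgebra (contractLeft contractLeft_ι_mul involute)

variable {ι H : Type*} [NormedAddCommGroup H] [InnerProductSpace ℂ H]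

theorem expSeries_eq_sum {mul : Grassmann ι H → Grassmann ι H → Grassmann ι H} {x : Grassmann ι H}
    {N : ℕ} (h : ∀ r, N ≤ r → (mul x)^[r] 1 = 0) :
    expSeries mul x = ∑ r ∈ Finset.range N, (r.factorial : ℂ)⁻¹ • (mul x)^[r] 1 :=
  letI : TopologicalSpace (Grassmann ι H) := moduleTopology ℂ (Grassmann ι H)
  tsum_eq_sum fun r hr => by rw [h r (by simpa using hr), smul_zero]

theorem inv_factorial_smul_eq {V : Type*} [AddCommGroup V] [Module ℂ V]
    {Q : QuadraticForm ℂ V} (r : ℕ) (x : CliffordAlgebra Q) :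
    (r.factorial : ℂ)⁻¹ • x = (r.factorial : ℚ)⁻¹ • x :=
  inv_natCast_smul_eq ℂ ℚ r.factorial x

theorem wedgeExp_eq_exp {x : Grassmann ι H} (hx : IsNilpotent x) :
    wedgeExp x = IsNilpotent.exp x := by
  obtain ⟨N, hN⟩ := hx
  have hiter : ∀ r, (fun ζ => x * ζ)^[r] 1 = x ^ r := fun r => by
    rw [mul_left_iterate]
    exact mul_one _
  rw [IsNilpotent.exp_eq_sum hN, wedgeExp, expSeries_eq_sum (N := N) fun r hr => by
    rw [hiter, pow_eq_zero_of_le hr hN]]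
  simp only [hiter, inv_factorial_smul_eq]

/-- The functional `v ↦ ⟨φ, v_q⟩`. -/
def innerAt (q : ι) (φ : H) : Module.Dual ℂ (ι → H) :=
  innerₛₗ ℂ φ ∘ₗ LinearMap.proj q

theorem innerAt_apply (q : ι) (φ : H) (v : ι → H) : innerAt q φ v = inner ℂ φ (v q) :=
  rfl

variable {A : H →ₗ⋆[ℂ] H} {P : H →ₗ[ℂ] H} {n : ℕ}
  (χ : OrthonormalBasis (Fin n) ℂ (LinearMap.range P))

theorem innerAt_eq_sum (hA : IsSelfDual A) (hP : IsBasisProjection A P) (q : ι) (φ : H) :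
    innerAt q φ = ∑ p, inner ℂ φ (modeVector A χ p) • innerAt q (modeVector A χ p) := by
  refine LinearMap.ext fun v => ?_
  rw [innerAt_apply, ← sum_inner_smul_modeVector χ hA hP (v q), inner_sum]
  simp [innerAt_apply, inner_smul_right, mul_comm]

theorem berezinIntegral_eq_iteratedContraction (q : ι) :
    berezinIntegral A χ q = iteratedContraction (fun j => innerAt q (χ j : H))
      (fun j => innerAt q (A (χ j))) (List.finRange n) := by
  rw [berezinIntegral, List.ofFn_eq_map]
  rfl

theorem berezinIntegral_contractLeft (hA : IsSelfDual A) (hP : IsBasisProjection A P) (q : ι)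
    (φ : H) (x : Grassmann ι H) : berezinIntegral A χ q (contractLeft (innerAt q φ) x) = 0 := by
  have hmode : ∀ p, berezinIntegral A χ q (contractLeft (innerAt q (modeVector A χ p)) x) = 0 := by
    rintro ⟨a, j⟩
    rw [berezinIntegral_eq_iteratedContraction]
    have h := iteratedContraction_contractLeft_of_mem (f := fun j => innerAt q (χ j : H))
      (g := fun j => innerAt q (A (χ j))) (List.mem_finRange j) x
    fin_cases a
    exacts [h.1, h.2]
  rw [innerAt_eq_sum χ hA hP]
  simp only [map_sum, map_smul, LinearMap.sum_apply, LinearMap.smul_apply, hmode, smul_zero,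
    Finset.sum_const_zero]

variable [DecidableEq ι]

theorem bilin_eq_bivectorSum (p q : ι) :
    bilin A χ p q = bivectorSum (fun j => Pi.single q (χ j : H))
      (fun j => Pi.single p (A (χ j))) (List.finRange n) := by
  rw [bilin, Fin.sum_univ_def]
  rfl

/-- The vector `φ^(a) - φ^(k)`, where `a` is the auxiliary copy: the variable of the Gaussian factor
of the circle product. -/
def auxDiff (k : ι) : H →ₗ[ℂ] Option ι → H :=
  LinearMap.single ℂ (fun _ : Option ι => H) none -
    LinearMap.single ℂ (fun _ : Option ι => H) (some k)

theorem auxDiff_apply (k : ι) (φ : H) :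
    auxDiff k φ = Pi.single none φ - Pi.single (some k) φ :=
  rfl

theorem wedgeExp_bilin_mul_eq_exp (k : ι) :
    wedgeExp (-bilin A χ (some k) (some k)) * wedgeExp (bilin A χ (some k) none) *
        wedgeExp (-bilin A χ none none) * wedgeExp (bilin A χ none (some k)) =
      IsNilpotent.exp (-bivectorSum (fun j => auxDiff k (χ j : H))
        (fun j => auxDiff k (A (χ j))) (List.finRange n)) := by
  have hcomm : ∀ p q (x : Grassmann (Option ι) H), Commute (bilin A χ p q) x := fun p q x =>
    bilin_eq_bivectorSum χ p q ▸ commute_bivectorSum _ x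
  have hnil : ∀ p q : Option ι, IsNilpotent (bilin A χ p q) := fun p q =>
    bilin_eq_bivectorSum χ p q ▸ isNilpotent_bivectorSum _
  have hsum : -bilin A χ (some k) (some k) + bilin A χ (some k) none + -bilin A χ none none +
      bilin A χ none (some k) = -bivectorSum (fun j => auxDiff k (χ j : H))
        (fun j => auxDiff k (A (χ j))) (List.finRange n) := by
    rw [bivectorSum, ← Fin.sum_univ_def]
    simp only [bilin, copy, auxDiff_apply, map_sub, sub_mul, mul_sub, Finset.sum_sub_distrib]
    abel
  have h₂ := (hcomm (some k) none (-bilin A χ (some k) (some k))).symm.isNilpotent_add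
    (hnil _ _).neg (hnil _ _)
  have h₃ := (hcomm none none (-bilin A χ (some k) (some k) + bilin A χ (some k)
    none)).symm.neg_right.isNilpotent_add h₂ (hnil none none).neg
  rw [wedgeExp_eq_exp (hnil _ _).neg, wedgeExp_eq_exp (hnil _ _), wedgeExp_eq_exp (hnil _ _).neg,
    wedgeExp_eq_exp (hnil _ _), ← hsum,
    IsNilpotent.exp_add_of_commute (hcomm _ _ _).symm h₃ (hnil _ _),
    IsNilpotent.exp_add_of_commute (hcomm _ _ _).symm.neg_right h₂ (hnil _ _).neg,
    IsNilpotent.exp_add_of_commute (hcomm _ _ _).symm (hnil _ _).neg (hnil _ _)]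

/-- Integration over the auxiliary copy against the Gaussian factor of the circle product, with its
normalization. -/
def gaussianIntegral (A : H →ₗ⋆[ℂ] H) (χ : OrthonormalBasis (Fin n) ℂ (LinearMap.range P))
    (k : ι) : Grassmann (Option ι) H →ₗ[ℂ] Grassmann ι H :=
  (-1 : ℂ) ^ (Module.finrank ℂ H / 2) • forget.toLinearMap ∘ₗ berezinIntegral A χ none ∘ₗ
    LinearMap.mulRight ℂ (IsNilpotent.exp (-bivectorSum (fun j => auxDiff k (χ j : H))
      (fun j => auxDiff k (A (χ j))) (List.finRange n)))

theorem gaussianIntegral_one (hA : IsSelfDual A) (hP : IsBasisProjection A P) (k : ι) :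
    gaussianIntegral A χ k 1 = 1 := by
  have h := iteratedContraction_gaussian (f := fun j => innerAt none (χ j : H))
    (g := fun j => innerAt none (A (χ j))) (a := fun j => auxDiff k (χ j : H))
    (b := fun j => auxDiff k (A (χ j))) (by simp [innerAt_apply, auxDiff_apply, inner_coe])
    (by simp [innerAt_apply, auxDiff_apply, inner_coe_conj χ hA hP])
    (by simp [innerAt_apply, auxDiff_apply, inner_conj_coe χ hA hP])
    (by simp [innerAt_apply, auxDiff_apply, inner_conj_conj χ hA]) (List.nodup_finRange n)
  rw [gaussianIntegral, finrank_eq_two_mul χ hA hP]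
  simp only [LinearMap.smul_apply, LinearMap.comp_apply, LinearMap.mulRight_apply, one_mul,
    berezinIntegral_eq_iteratedContraction, h]
  rw [AlgHom.toLinearMap_apply, map_pow, map_neg, map_one, List.length_finRange,
    Nat.mul_div_cancel_left n two_pos, ← smul_pow, neg_smul, one_smul, neg_neg, one_pow]

theorem gaussianIntegral_ι_mul_of_none_eq_zero {s : Option ι → H} (hs : s none = 0) (k : ι)
    (x : Grassmann (Option ι) H) :
    gaussianIntegral A χ k (ExteriorAlgebra.ι ℂ s * x) =
      ExteriorAlgebra.ι ℂ (fun q => s (some q)) * gaussianIntegral A χ k x := by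
  simp only [gaussianIntegral, berezinIntegral_eq_iteratedContraction, LinearMap.smul_apply,
    LinearMap.comp_apply, LinearMap.mulRight_apply, mul_assoc]
  rw [iteratedContraction_ι_mul (by simp [innerAt_apply, hs]) (by simp [innerAt_apply, hs]),
    AlgHom.toLinearMap_apply, map_mul, AlgHom.toLinearMap_apply, mul_smul_comm]
  congr 2
  exact ExteriorAlgebra.map_apply_ι _ _

theorem contractLeft_bivectorSum_auxDiff (hA : IsSelfDual A) (hP : IsBasisProjection A P) (k : ι)
    (η : H) :
    contractLeft (innerAt none (A η)) (bivectorSum (fun j => auxDiff k (χ j : H))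
        (fun j => auxDiff k (A (χ j))) (List.finRange n)) =
      ExteriorAlgebra.ι ℂ (auxDiff k (P η - (η - P η))) := by
  have hpos : ∀ j, innerAt none (A η) (auxDiff k (A (χ j))) = inner ℂ (χ j : H) η := fun j => by
    simp [innerAt_apply, auxDiff_apply, hA.inner_map]
  have hneg : ∀ j, innerAt none (A η) (auxDiff k (χ j : H)) = inner ℂ (A (χ j)) η := fun j => by
    simp [innerAt_apply, auxDiff_apply, hA.inner_left]
  rw [contractLeft_bivectorSum, ← Fin.sum_univ_def]
  simp only [hpos, hneg, ← map_smul, Finset.sum_sub_distrib, ← map_sum, hP.sum_inner_smul,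
    hP.sum_inner_conj_smul χ hA, map_sub]

theorem gaussianIntegral_ι_auxDiff_mul (hA : IsSelfDual A) (hP : IsBasisProjection A P) (k : ι)
    (φ : H) (x : Grassmann (Option ι) H) :
    gaussianIntegral A χ k (ExteriorAlgebra.ι ℂ (auxDiff k φ) * x) =
      gaussianIntegral A χ k
        (contractLeft (innerAt none (A (P φ - (φ - P φ)))) x) := by
  have hφ : P (P φ - (φ - P φ)) - (P φ - (φ - P φ) - P (P φ - (φ - P φ))) = φ := by
    simp only [map_sub, hP.map_map]
    abel
  have hv := contractLeft_bivectorSum_auxDiff χ hA hP k (P φ - (φ - P φ))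
  rw [hφ] at hv
  exact congrArg (fun y => (-1 : ℂ) ^ (Module.finrank ℂ H / 2) • forget y)
    (integral_ι_mul_mul_gaussian (berezinIntegral_contractLeft χ hA hP none _) hv x)

theorem gaussianIntegral_ι_mul (hA : IsSelfDual A) (hP : IsBasisProjection A P) (k : ι)
    (u : Option ι → H) (x : Grassmann (Option ι) H) :
    gaussianIntegral A χ k (ExteriorAlgebra.ι ℂ u * x) =
      ExteriorAlgebra.ι ℂ ((fun q => u (some q)) + Pi.single k (u none)) *
          gaussianIntegral A χ k x +
        gaussianIntegral A χ k
          (contractLeft (innerAt none (A (P (u none) - (u none - P (u none))))) x) := by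
  have hu : u = (u - auxDiff k (u none)) + auxDiff k (u none) := (sub_add_cancel _ _).symm
  have hnone : (u - auxDiff k (u none)) none = 0 := by simp [auxDiff_apply]
  have hsome : (fun q => (u - auxDiff k (u none)) (some q)) =
      (fun q => u (some q)) + Pi.single k (u none) := by
    ext q
    simp [auxDiff_apply, Pi.single_apply]
  conv_lhs => rw [hu, map_add, add_mul, map_add]
  rw [gaussianIntegral_ι_mul_of_none_eq_zero χ hnone, gaussianIntegral_ι_auxDiff_mul χ hA hP, hsome]

end GaussianIntegral

section Circle

open CliffordAlgebra (contractLeft involute)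

variable {ι H : Type*} [NormedAddCommGroup H] [InnerProductSpace ℂ H]

/-- The contraction `(v, w) ↦ ⟨A P v_k, w_k⟩` of degree one vectors under the circle product. -/
def contraction (A : H →ₗ⋆[ℂ] H) (P : H →ₗ[ℂ] H) (k : ι) : LinearMap.BilinForm ℂ (ι → H) :=
  LinearMap.mk₂ ℂ (fun v w => inner ℂ (A (P (v k))) (w k))
    (fun v v' w => by simp) (fun c v w => by simp [mul_comm])
    (fun v w w' => inner_add_right _ _ _) (fun c v w => inner_smul_right _ _ _)

theorem contraction_apply (A : H →ₗ⋆[ℂ] H) (P : H →ₗ[ℂ] H) (k : ι) (v w : ι → H) :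
    contraction A P k v w = inner ℂ (A (P (v k))) (w k) :=
  rfl

variable [Fintype ι] [DecidableEq ι]

/-- The map of degree one vectors underlying `kappa`. -/
def kappaVector (P : H →ₗ[ℂ] H) (k : ι) (a b : Option ι) : (ι → H) →ₗ[ℂ] (Option ι → H) :=
  LinearMap.single ℂ (fun _ : Option ι => H) a ∘ₗ (LinearMap.id - P) ∘ₗ LinearMap.proj k
    + LinearMap.single ℂ (fun _ : Option ι => H) b ∘ₗ P ∘ₗ LinearMap.proj k
    + ∑ q ∈ Finset.univ.erase k,
        LinearMap.single ℂ (fun _ : Option ι => H) (some q) ∘ₗ LinearMap.proj q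

theorem kappa_ι_mul (P : H →ₗ[ℂ] H) (k : ι) (a b : Option ι) (v : ι → H) (x : Grassmann ι H) :
    kappa P k a b (ExteriorAlgebra.ι ℂ v * x) =
      ExteriorAlgebra.ι ℂ (kappaVector P k a b v) * kappa P k a b x := by
  rw [map_mul]
  exact congrArg (· * _) (ExteriorAlgebra.map_apply_ι _ v)

theorem kappaVector_none (P : H →ₗ[ℂ] H) (k : ι) (a b : Option ι) (v : ι → H) :
    kappaVector P k a b v none =
      (if a = none then v k - P (v k) else 0) + if b = none then P (v k) else 0 := by
  simp [kappaVector, Pi.single_apply, eq_comm]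

theorem kappaVector_some_self (P : H →ₗ[ℂ] H) (k : ι) (a b : Option ι) (v : ι → H) :
    kappaVector P k a b v (some k) =
      (if a = some k then v k - P (v k) else 0) + if b = some k then P (v k) else 0 := by
  simp [kappaVector, Pi.single_apply, eq_comm]

theorem kappaVector_some_of_ne (P : H →ₗ[ℂ] H) {k q : ι} (hq : q ≠ k) {a b : Option ι}
    (ha : a ≠ some q) (hb : b ≠ some q) (v : ι → H) :
    kappaVector P k a b v (some q) = v q := by
  simp [kappaVector, Pi.single_apply, ha.symm, hb.symm, hq]

theorem kappaVector_left (P : H →ₗ[ℂ] H) (k : ι) (v : ι → H) :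
    (fun q => kappaVector P k (some k) none v (some q)) +
      Pi.single k (kappaVector P k (some k) none v none) = v := by
  funext q
  rcases eq_or_ne q k with rfl | hq
  · simp [kappaVector_some_self, kappaVector_none]
  · simp [kappaVector_some_of_ne P hq, hq, hq.symm]

theorem kappaVector_right (P : H →ₗ[ℂ] H) (k : ι) (v : ι → H) :
    (fun q => kappaVector P k none (some k) v (some q)) +
      Pi.single k (kappaVector P k none (some k) v none) = v := by
  funext q
  rcases eq_or_ne q k with rfl | hq
  · simp [kappaVector_some_self, kappaVector_none]
  · simp [kappaVector_some_of_ne P hq, hq, hq.symm]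

variable {A : H →ₗ⋆[ℂ] H} {P : H →ₗ[ℂ] H} {n : ℕ}
  (χ : OrthonormalBasis (Fin n) ℂ (LinearMap.range P)) (k : ι)

theorem circ_eq_gaussianIntegral (ξ ζ : Grassmann ι H) :
    circ A χ k ξ ζ =
      gaussianIntegral A χ k (kappa P k (some k) none ξ * kappa P k none (some k) ζ) := by
  rw [gaussianIntegral, ← wedgeExp_bilin_mul_eq_exp, circ]
  simp only [LinearMap.smul_apply, LinearMap.comp_apply, LinearMap.mulRight_apply,
    AlgHom.toLinearMap_apply, mul_assoc]

theorem contractLeft_kappa (a b : Option ι) (φ : H) (x : Grassmann ι H) :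
    contractLeft (innerAt none φ) (kappa P k a b x) =
      kappa P k a b (contractLeft (innerAt none φ ∘ₗ kappaVector P k a b) x) :=
  contractLeft_map _ _ _

theorem innerAt_comp_kappaVector_left (hA : IsSelfDual A) (hP : IsBasisProjection A P) (φ : H) :
    innerAt none (A (P φ)) ∘ₗ kappaVector P k (some k) none = 0 := by
  refine LinearMap.ext fun v => ?_
  simp [innerAt_apply, kappaVector_none, ← hP.isSymmetricProjection.isSymmetric _ (v k),
    hP.map_conj hA, hP.map_map]

theorem innerAt_comp_kappaVector_right (hA : IsSelfDual A) (hP : IsBasisProjection A P) (φ : H) :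
    innerAt none (A (φ - P φ)) ∘ₗ kappaVector P k none (some k) = 0 := by
  refine LinearMap.ext fun v => ?_
  simp [innerAt_apply, kappaVector_none, ← hP.isSymmetricProjection.isSymmetric _ (v k),
    hP.map_conj hA, hP.map_map, inner_sub_left]

theorem innerAt_comp_kappaVector_eq_contraction (hA : IsSelfDual A) (hP : IsBasisProjection A P)
    (v : ι → H) :
    innerAt none (A (P (v k))) ∘ₗ kappaVector P k none (some k) = contraction A P k v := by
  refine LinearMap.ext fun w => ?_
  simp [innerAt_apply, kappaVector_none, ← hP.isSymmetricProjection.isSymmetric _ (w k),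
    hP.map_conj hA, hP.map_map, contraction_apply]

theorem circ_one_left (hA : IsSelfDual A) (hP : IsBasisProjection A P) (ζ : Grassmann ι H) :
    circ A χ k 1 ζ = ζ := by
  rw [circ_eq_gaussianIntegral, map_one, one_mul]
  induction ζ using CliffordAlgebra.left_induction with
  | algebraMap r =>
    rw [AlgHom.commutes, Algebra.algebraMap_eq_smul_one, map_smul, gaussianIntegral_one χ hA hP,
      ← Algebra.algebraMap_eq_smul_one]
  | add x y hx hy => rw [map_add, map_add, hx, hy]
  | ι_mul x v hx =>
    have hnone : kappaVector P k none (some k) v none = v k - P (v k) := by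
      simp [kappaVector_none]
    have hcontr : A (P (v k - P (v k)) - (v k - P (v k) - P (v k - P (v k)))) =
        -A (v k - P (v k)) := by
      simp [hP.map_map]
    have hzero : contractLeft (innerAt none (-A (v k - P (v k)))) (kappa P k none (some k) x) =
        0 := by
      have hneg : -A (v k - P (v k)) = A (-v k - P (-v k)) := by
        simp only [map_sub, map_neg]
        abel
      rw [hneg, contractLeft_kappa, innerAt_comp_kappaVector_right k hA hP, map_zero,
        LinearMap.zero_apply, map_zero]
    change gaussianIntegral A χ k (kappa P k none (some k) (ExteriorAlgebra.ι ℂ v * x)) = _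
    rw [kappa_ι_mul, gaussianIntegral_ι_mul χ hA hP, kappaVector_right, hx, hnone, hcontr, hzero,
      map_zero, add_zero]

theorem circ_ι_mul (hA : IsSelfDual A) (hP : IsBasisProjection A P) (v : ι → H)
    (ξ ζ : Grassmann ι H) :
    circ A χ k (ExteriorAlgebra.ι ℂ v * ξ) ζ =
      ExteriorAlgebra.ι ℂ v * circ A χ k ξ ζ +
        circ A χ k (involute ξ) (contractLeft (contraction A P k v) ζ) := by
  have hnone : kappaVector P k (some k) none v none = P (v k) := by
    simp [kappaVector_none]
  have hproj : P (P (v k)) - (P (v k) - P (P (v k))) = P (v k) := by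
    rw [hP.map_map, sub_self, sub_zero]
  have hinv : involute (kappa P k (some k) none ξ) = kappa P k (some k) none (involute ξ) :=
    involute_map _ _
  simp only [circ_eq_gaussianIntegral]
  rw [kappa_ι_mul, mul_assoc, gaussianIntegral_ι_mul χ hA hP, kappaVector_left, hnone, hproj,
    contractLeft_mul, contractLeft_kappa, innerAt_comp_kappaVector_left k hA hP, map_zero,
    LinearMap.zero_apply, map_zero, zero_mul, zero_add, contractLeft_kappa,
    innerAt_comp_kappaVector_eq_contraction k hA hP, hinv]

/-- The circle product as a bilinear map. -/
def circBilin (A : H →ₗ⋆[ℂ] H) (χ : OrthonormalBasis (Fin n) ℂ (LinearMap.range P)) (k : ι) :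
    Grassmann ι H →ₗ[ℂ] Grassmann ι H →ₗ[ℂ] Grassmann ι H :=
  (LinearMap.mul ℂ _).compl₁₂ (kappa P k (some k) none).toLinearMap
    (kappa P k none (some k)).toLinearMap |>.compr₂ (gaussianIntegral A χ k)

theorem circBilin_apply (ξ ζ : Grassmann ι H) : circBilin A χ k ξ ζ = circ A χ k ξ ζ :=
  (circ_eq_gaussianIntegral χ k ξ ζ).symm

theorem toClifford_circ (hA : IsSelfDual A) (hP : IsBasisProjection A P) (ξ ζ : Grassmann ι H) :
    toClifford (contraction A P k) (circ A χ k ξ ζ) =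
      toClifford (contraction A P k) ξ * toClifford (contraction A P k) ζ := by
  rw [← circBilin_apply]
  refine toClifford_eq_mul _ (fun ζ => ?_) (fun v ξ ζ => ?_) ξ ζ
  · rw [circBilin_apply, circ_one_left χ k hA hP]
  · simp only [circBilin_apply, circ_ι_mul χ k hA hP]

theorem toClifford_circ_iterate (hA : IsSelfDual A) (hP : IsBasisProjection A P)
    (ξ : Grassmann ι H) (r : ℕ) :
    toClifford (contraction A P k) ((circ A χ k ξ)^[r] 1) =
      toClifford (contraction A P k) ξ ^ r := by
  induction r with
  | zero => rw [Function.iterate_zero_apply, toClifford_one, pow_zero]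
  | succ r ih => rw [Function.iterate_succ_apply', toClifford_circ χ k hA hP, ih, pow_succ']

theorem circExp_eq_sum (hA : IsSelfDual A) (hP : IsBasisProjection A P) {ξ : Grassmann ι H} {N : ℕ}
    (hN : toClifford (contraction A P k) ξ ^ N = 0) :
    circExp A χ k ξ = ∑ r ∈ Finset.range N, (r.factorial : ℂ)⁻¹ • (circ A χ k ξ)^[r] 1 :=
  expSeries_eq_sum fun r hr => (toClifford (contraction A P k)).injective (by
    rw [toClifford_circ_iterate χ k hA hP, pow_eq_zero_of_le hr hN, map_zero])

theorem toClifford_circExp (hA : IsSelfDual A) (hP : IsBasisProjection A P) {ξ : Grassmann ι H}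
    (hξ : IsNilpotent (toClifford (contraction A P k) ξ)) :
    toClifford (contraction A P k) (circExp A χ k ξ) =
      IsNilpotent.exp (toClifford (contraction A P k) ξ) := by
  obtain ⟨N, hN⟩ := hξ
  rw [circExp_eq_sum χ k hA hP hN, IsNilpotent.exp_eq_sum hN, map_sum]
  refine Finset.sum_congr rfl fun r _ => ?_
  rw [map_smul, toClifford_circ_iterate χ k hA hP, inv_factorial_smul_eq]

end Circle

section Involution

open CliffordAlgebra (contractLeft involute contractLeft_ι_mul contractLeft_ι)

variable {ι H : Type*} [NormedAddCommGroup H] [InnerProductSpace ℂ H] {A : H →ₗ⋆[ℂ] H}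

/-- The involution of the Grassmann algebra as an algebra homomorphism into the conjugate opposite
algebra. -/
def grassStarHom (A : H →ₗ⋆[ℂ] H) : Grassmann ι H →ₐ[ℂ] ConjOp (Grassmann ι H) :=
  ExteriorAlgebra.lift ℂ ⟨starGen A, starGen_sq A⟩

/-- The involution of the Grassmann algebra as an antilinear map. -/
def grassStarₗ (A : H →ₗ⋆[ℂ] H) : Grassmann ι H →ₗ⋆[ℂ] Grassmann ι H where
  toFun := grassStar A
  map_add' x y := congrArg (MulOpposite.unop (α := Grassmann ι H)) (map_add (grassStarHom A) x y)
  map_smul' r x := by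
    have h : grassStarHom A (r • x) = algebraMap ℂ _ r * grassStarHom A x := by
      rw [map_smul, Algebra.smul_def]
    refine (congrArg (MulOpposite.unop (α := Grassmann ι H)) h).trans ?_
    rw [Algebra.smul_def, Algebra.commutes]
    rfl

theorem grassStarₗ_apply (x : Grassmann ι H) : grassStarₗ A x = grassStar A x :=
  rfl

theorem grassStarₗ_one : grassStarₗ A (1 : Grassmann ι H) = 1 :=
  congrArg (MulOpposite.unop (α := Grassmann ι H)) (map_one (grassStarHom A))

theorem grassStarₗ_mul (x y : Grassmann ι H) :
    grassStarₗ A (x * y) = grassStarₗ A y * grassStarₗ A x :=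
  congrArg (MulOpposite.unop (α := Grassmann ι H)) (map_mul (grassStarHom A) x y)

theorem grassStarₗ_ι (v : ι → H) :
    grassStarₗ A (ExteriorAlgebra.ι ℂ v) = ExteriorAlgebra.ι ℂ fun q => A (v q) :=
  congrArg (MulOpposite.unop (α := Grassmann ι H))
    (ExteriorAlgebra.lift_ι_apply (A := ConjOp (Grassmann ι H)) ℂ _ (starGen_sq A) v)

theorem grassStarₗ_algebraMap (r : ℂ) :
    grassStarₗ A (algebraMap ℂ (Grassmann ι H) r) = algebraMap ℂ _ (starRingEnd ℂ r) := by
  rw [Algebra.algebraMap_eq_smul_one, LinearMap.map_smulₛₗ, grassStarₗ_one,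
    ← Algebra.algebraMap_eq_smul_one]

theorem grassStarₗ_copy [DecidableEq ι] (q : ι) (φ : H) :
    grassStarₗ A (copy q φ) = copy q (A φ) := by
  have h : (fun p => A ((Pi.single q φ : ι → H) p)) = Pi.single q (A φ) :=
    funext fun p => Pi.apply_single (fun _ => A) (fun _ => map_zero A) q φ p
  rw [copy, grassStarₗ_ι, h, copy]

theorem grassStarₗ_involute (x : Grassmann ι H) :
    grassStarₗ A (involute x) = involute (grassStarₗ A x) := by
  induction x using CliffordAlgebra.left_induction with
  | algebraMap r => rw [AlgHom.commutes, grassStarₗ_algebraMap, AlgHom.commutes]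
  | add x y hx hy => simp only [map_add, hx, hy]
  | ι_mul x v hx =>
    change grassStarₗ A (involute (ExteriorAlgebra.ι ℂ v * x)) =
      involute (grassStarₗ A (ExteriorAlgebra.ι ℂ v * x))
    have hv : involute (ExteriorAlgebra.ι ℂ fun q => A (v q)) =
        -ExteriorAlgebra.ι ℂ fun q => A (v q) := CliffordAlgebra.involute_ι _
    rw [involute_ι_mul, map_neg, grassStarₗ_mul, grassStarₗ_mul, map_mul, hx, grassStarₗ_ι, hv,
      mul_neg]

theorem contractLeft_grassStarₗ {d d' : Module.Dual ℂ (ι → H)}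
    (hd : ∀ v, d (fun q => A (v q)) = starRingEnd ℂ (d' v)) (x : Grassmann ι H) :
    contractLeft d (grassStarₗ A x) = -grassStarₗ A (contractLeft d' (involute x)) := by
  induction x using CliffordAlgebra.left_induction with
  | algebraMap r =>
    rw [grassStarₗ_algebraMap, AlgHom.commutes, CliffordAlgebra.contractLeft_algebraMap,
      CliffordAlgebra.contractLeft_algebraMap, map_zero, neg_zero]
  | add x y hx hy => simp only [map_add, hx, hy, neg_add]
  | ι_mul x v hx =>
    change contractLeft d (grassStarₗ A (ExteriorAlgebra.ι ℂ v * x)) =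
      -grassStarₗ A (contractLeft d' (involute (ExteriorAlgebra.ι ℂ v * x)))
    have hv : contractLeft d' (ExteriorAlgebra.ι ℂ v * involute x) =
        d' v • involute x - ExteriorAlgebra.ι ℂ v * contractLeft d' (involute x) :=
      contractLeft_ι_mul _ _ _
    have hAv : contractLeft d (ExteriorAlgebra.ι ℂ fun q => A (v q)) =
        algebraMap ℂ (Grassmann ι H) (starRingEnd ℂ (d' v)) :=
      (contractLeft_ι _ _ _).trans (by rw [hd])
    rw [grassStarₗ_mul, contractLeft_mul, hx, grassStarₗ_ι, hAv, ← grassStarₗ_involute,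
      involute_ι_mul, map_neg, map_neg, neg_neg, hv, map_sub, LinearMap.map_smulₛₗ,
      grassStarₗ_mul, grassStarₗ_ι, ← Algebra.commutes, ← Algebra.smul_def, neg_mul,
      neg_add_eq_sub]

variable {P : H →ₗ[ℂ] H}

theorem contraction_conj (hA : IsSelfDual A) (hP : IsBasisProjection A P) (k : ι) (v w : ι → H) :
    contraction A P k (fun q => A (w q)) (fun q => A (v q)) =
      starRingEnd ℂ (contraction A P k v w) := by
  rw [contraction_apply, contraction_apply, hA.inner_map, inner_conj_symm,
    ← hP.isSymmetricProjection.isSymmetric, hA.inner_right]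

variable [Fintype ι] [DecidableEq ι] {n : ℕ}
  (χ : OrthonormalBasis (Fin n) ℂ (LinearMap.range P)) (k : ι)

theorem circ_one_right (hA : IsSelfDual A) (hP : IsBasisProjection A P) (x : Grassmann ι H) :
    circ A χ k x 1 = x :=
  (toClifford (contraction A P k)).injective (by
    rw [toClifford_circ χ k hA hP, toClifford_one, mul_one])

theorem circ_assoc (hA : IsSelfDual A) (hP : IsBasisProjection A P) (x y z : Grassmann ι H) :
    circ A χ k (circ A χ k x y) z = circ A χ k x (circ A χ k y z) :=
  (toClifford (contraction A P k)).injective (by simp only [toClifford_circ χ k hA hP, mul_assoc])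

theorem circ_ι_left (hA : IsSelfDual A) (hP : IsBasisProjection A P) (v : ι → H)
    (x : Grassmann ι H) :
    circ A χ k (ExteriorAlgebra.ι ℂ v) x =
      ExteriorAlgebra.ι ℂ v * x + contractLeft (contraction A P k v) x := by
  simpa only [mul_one, map_one, circ_one_left χ k hA hP] using circ_ι_mul χ k hA hP v 1 x

theorem circ_ι_right (hA : IsSelfDual A) (hP : IsBasisProjection A P) (x : Grassmann ι H)
    (v : ι → H) :
    circ A χ k x (ExteriorAlgebra.ι ℂ v) =
      x * ExteriorAlgebra.ι ℂ v - contractLeft ((contraction A P k).flip v) (involute x) :=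
  (toClifford (contraction A P k)).injective (by
    rw [toClifford_circ χ k hA hP, map_sub, toClifford_mul_ι, toClifford_contractLeft, toClifford_ι,
      add_sub_cancel_right])

theorem grassStarₗ_circ_ι (hA : IsSelfDual A) (hP : IsBasisProjection A P) (v : ι → H)
    (x : Grassmann ι H) :
    grassStarₗ A (circ A χ k (ExteriorAlgebra.ι ℂ v) x) =
      circ A χ k (grassStarₗ A x) (grassStarₗ A (ExteriorAlgebra.ι ℂ v)) := by
  have hcontr := contractLeft_grassStarₗ (d := (contraction A P k).flip fun q => A (v q))
    (d' := contraction A P k v) (fun w => contraction_conj hA hP k v w) (involute x)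
  rw [CliffordAlgebra.involute_involute] at hcontr
  rw [circ_ι_left χ k hA hP, map_add, grassStarₗ_mul, grassStarₗ_ι, circ_ι_right χ k hA hP,
    ← grassStarₗ_involute, hcontr, sub_neg_eq_add]

theorem grassStarₗ_circ (hA : IsSelfDual A) (hP : IsBasisProjection A P) (x y : Grassmann ι H) :
    grassStarₗ A (circ A χ k x y) = circ A χ k (grassStarₗ A y) (grassStarₗ A x) := by
  obtain ⟨X, rfl⟩ := (toClifford (contraction A P k)).symm.surjective x
  induction X using CliffordAlgebra.left_induction generalizing y with
  | algebraMap r =>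
    have h : (toClifford (contraction A P k)).symm (algebraMap ℂ _ r) = r • 1 := by
      rw [LinearEquiv.symm_apply_eq, map_smul, toClifford_one, Algebra.algebraMap_eq_smul_one]
    simp only [h, ← circBilin_apply, map_smul, LinearMap.smul_apply, LinearMap.map_smulₛₗ,
      grassStarₗ_one]
    simp only [circBilin_apply, circ_one_left χ k hA hP, circ_one_right χ k hA hP]
  | add X Y hX hY =>
    simp only [← circBilin_apply, map_add, LinearMap.add_apply] at hX hY ⊢
    rw [hX, hY]
  | ι_mul X v hX =>
    have h : (toClifford (contraction A P k)).symm (CliffordAlgebra.ι _ v * X) =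
        circ A χ k (ExteriorAlgebra.ι ℂ v) ((toClifford (contraction A P k)).symm X) := by
      rw [LinearEquiv.symm_apply_eq, toClifford_circ χ k hA hP, toClifford_ι,
        LinearEquiv.apply_symm_apply]
    rw [h, circ_assoc χ k hA hP, grassStarₗ_circ_ι χ k hA hP, hX, circ_assoc χ k hA hP,
      grassStarₗ_circ_ι χ k hA hP]

theorem toClifford_grassStarₗ_circ_iterate (hA : IsSelfDual A) (hP : IsBasisProjection A P)
    {x : Grassmann ι H} (hx : grassStarₗ A x = -x) (r : ℕ) :
    toClifford (contraction A P k) (grassStarₗ A ((circ A χ k x)^[r] 1)) =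
      (-toClifford (contraction A P k) x) ^ r := by
  induction r with
  | zero => rw [Function.iterate_zero_apply, grassStarₗ_one, toClifford_one, pow_zero]
  | succ r ih =>
    rw [Function.iterate_succ_apply', grassStarₗ_circ χ k hA hP, toClifford_circ χ k hA hP, ih,
      hx, map_neg, pow_succ]

theorem toClifford_grassStar_circExp (hA : IsSelfDual A) (hP : IsBasisProjection A P)
    {x : Grassmann ι H} (hnil : IsNilpotent (toClifford (contraction A P k) x))
    (hx : grassStarₗ A x = -x) :
    toClifford (contraction A P k) (grassStar A (circExp A χ k x)) =
      IsNilpotent.exp (-toClifford (contraction A P k) x) := by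
  obtain ⟨N, hN⟩ := hnil
  rw [circExp_eq_sum χ k hA hP hN, IsNilpotent.exp_eq_sum (k := N) (by rw [neg_pow, hN, mul_zero]),
    ← grassStarₗ_apply, map_sum, map_sum]
  refine Finset.sum_congr rfl fun r _ => ?_
  rw [LinearMap.map_smulₛₗ, map_smul, toClifford_grassStarₗ_circ_iterate χ k hA hP hx, map_inv₀,
    map_natCast, inv_factorial_smul_eq]

end Involution

section Displacement

variable {ι H : Type*} [DecidableEq ι] [NormedAddCommGroup H] [InnerProductSpace ℂ H]

/-- The image `φ^(q)` of a vector in the Clifford algebra attached to the circle product. -/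
def generator (A : H →ₗ⋆[ℂ] H) (P : H →ₗ[ℂ] H) (k q : ι) :
    H →ₗ[ℂ] CliffordAlgebra (contraction A P k).toQuadraticMap :=
  CliffordAlgebra.ι _ ∘ₗ LinearMap.single ℂ (fun _ : ι => H) q

variable {A : H →ₗ⋆[ℂ] H} {P : H →ₗ[ℂ] H} {k q r : ι}

theorem toClifford_copy (φ : H) :
    toClifford (contraction A P k) (copy q φ) = generator A P k q φ :=
  toClifford_ι _ _

theorem generator_mul_add_swap (φ θ : H) :
    generator A P k q φ * generator A P k r θ + generator A P k r θ * generator A P k q φ =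
      algebraMap ℂ _ (contraction A P k (Pi.single q φ) (Pi.single r θ) +
        contraction A P k (Pi.single r θ) (Pi.single q φ)) := by
  rw [← LinearMap.BilinMap.polar_toQuadraticMap]
  exact CliffordAlgebra.ι_mul_ι_add_swap _ _

theorem contraction_single_of_ne (hq : k ≠ q) (φ : H) :
    contraction A P k (Pi.single q φ) = 0 := by
  ext v
  simp [contraction_apply, hq]

theorem contraction_apply_single_of_ne (hq : k ≠ q) (v : ι → H) (φ : H) :
    contraction A P k v (Pi.single q φ) = 0 := by
  simp [contraction_apply, hq]

theorem generator_mul_swap (hq : k ≠ q) (φ θ : H) :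
    generator A P k q φ * generator A P k r θ = -(generator A P k r θ * generator A P k q φ) := by
  rw [← add_eq_zero_iff_eq_neg, generator_mul_add_swap, contraction_single_of_ne hq,
    contraction_apply_single_of_ne hq, LinearMap.zero_apply, add_zero, map_zero]

theorem generator_mul_self (hq : k ≠ q) (φ : H) :
    generator A P k q φ * generator A P k q φ = 0 := by
  refine (CliffordAlgebra.ι_sq_scalar _ _).trans ?_
  rw [LinearMap.BilinMap.toQuadraticMap_apply]
  exact (congrArg _ (contraction_apply_single_of_ne hq _ φ)).trans (map_zero _)

theorem generator_self_mul_add_swap (hA : IsSelfDual A) (hP : IsBasisProjection A P) (φ θ : H) :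
    generator A P k k φ * generator A P k k θ + generator A P k k θ * generator A P k k φ =
      algebraMap ℂ _ (inner ℂ (A φ) θ) := by
  rw [generator_mul_add_swap, contraction_apply, contraction_apply, Pi.single_eq_same,
    Pi.single_eq_same, hA.inner_left (P θ), ← hP.isSymmetricProjection.isSymmetric, hP.map_conj hA,
    ← inner_add_left, add_sub_cancel]

theorem commute_generator_mul_generator (hq : k ≠ q) (r s : ι) (φ θ η : H) :
    Commute (generator A P k q φ) (generator A P k r θ * generator A P k s η) := by
  rw [Commute, SemiconjBy, ← mul_assoc, generator_mul_swap hq, neg_mul, mul_assoc,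
    generator_mul_swap hq, mul_neg, neg_neg, mul_assoc]

theorem commute_generator_mul_generator_left (hq : k ≠ q) (hr : k ≠ r) (s : ι) (φ θ η : H) :
    Commute (generator A P k q φ * generator A P k r θ) (generator A P k s η) := by
  rw [Commute, SemiconjBy, mul_assoc, generator_mul_swap hr, mul_neg, ← mul_assoc,
    generator_mul_swap hq, neg_mul, neg_neg, mul_assoc]

theorem isNilpotent_generator_mul_generator (hq : k ≠ q) (φ θ : H) :
    IsNilpotent (generator A P k q φ * generator A P k r θ) := by
  refine ⟨2, ?_⟩
  rw [sq, ← mul_assoc, ← (commute_generator_mul_generator hq q r φ φ θ).eq, ← mul_assoc,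
    generator_mul_self hq, zero_mul, zero_mul]

theorem lie_generator_mul_generator (hA : IsSelfDual A) (hP : IsBasisProjection A P) (hq : k ≠ q)
    (φ θ η : H) :
    ⁅generator A P k q φ * generator A P k k θ, generator A P k k η⁆ =
      inner ℂ (A θ) η • generator A P k q φ := by
  have hswap := generator_mul_swap (A := A) (P := P) (r := k) hq φ η
  rw [Ring.lie_def, ← mul_assoc, ← neg_eq_iff_eq_neg.2 hswap, neg_mul, sub_neg_eq_add, mul_assoc,
    mul_assoc, ← mul_add, generator_self_mul_add_swap hA hP, ← Algebra.commutes,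
    ← Algebra.smul_def]

theorem lie_generator_mul_generators (hA : IsSelfDual A) (hP : IsBasisProjection A P)
    (hq : k ≠ q) (hr : k ≠ r) (φ θ φ' θ' : H) :
    ⁅generator A P k q φ * generator A P k k θ, generator A P k r φ' * generator A P k k θ'⁆ =
      generator A P k r φ' * generator A P k q (inner ℂ (A θ) θ' • φ) := by
  rw [map_smul, ← lie_generator_mul_generator hA hP hq, Ring.lie_def, Ring.lie_def, ← mul_assoc,
    ← (commute_generator_mul_generator hr q k φ' φ θ).eq]
  noncomm_ring

variable {n : ℕ} (ψ : OrthonormalBasis (Fin n) ℂ (LinearMap.range P))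

variable (A) in
/-- The image of `(ψ^(q), 𝒥 ψ^(r))` in the Clifford algebra attached to the circle product. -/
def cliffordPairing (k q r : ι) : CliffordAlgebra (contraction A P k).toQuadraticMap :=
  ∑ p, generator A P k q (modeVector A ψ p) * generator A P k r (A (modeVector A ψ p))

theorem commute_cliffordPairing_generator {m : ι} (hm : k ≠ m) (φ : H) :
    Commute (cliffordPairing A ψ k q r) (generator A P k m φ) :=
  Commute.sum_left _ _ _ fun _ _ => (commute_generator_mul_generator hm q r _ _ _).symm

theorem commute_cliffordPairing {q' r' : ι} (hq : k ≠ q) (hr : k ≠ r) :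
    Commute (cliffordPairing A ψ k q' r') (cliffordPairing A ψ k q r) :=
  Commute.sum_right _ _ _ fun _ _ => (commute_cliffordPairing_generator ψ hq _).mul_right
    (commute_cliffordPairing_generator ψ hr _)

theorem isNilpotent_cliffordPairing_of_ne (hq : k ≠ q) (hr : k ≠ r) :
    IsNilpotent (cliffordPairing A ψ k q r) :=
  Commute.isNilpotent_sum (fun _ _ => isNilpotent_generator_mul_generator hq _ _) fun _ _ _ _ =>
    (commute_generator_mul_generator_left hq hr _ _ _ _).mul_right
      (commute_generator_mul_generator_left hq hr _ _ _ _)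

theorem isNilpotent_cliffordPairing (hA : IsSelfDual A) (hP : IsBasisProjection A P)
    (hq : k ≠ q) : IsNilpotent (cliffordPairing A ψ k q k) := by
  refine isNilpotent_sum_of_commute_lie _
    (fun p => isNilpotent_generator_mul_generator hq _ _) (fun p p' => ?_) (fun p'' p p' => ?_)
  · rw [lie_generator_mul_generators hA hP hq hq]
    exact isNilpotent_generator_mul_generator hq _ _
  · rw [lie_generator_mul_generators hA hP hq hq]
    exact ((commute_generator_mul_generator_left hq hq _ _ _ _).mul_right
      (commute_generator_mul_generator_left hq hq _ _ _ _)).symm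

theorem lie_cliffordPairing_generator (hA : IsSelfDual A) (hP : IsBasisProjection A P)
    (hq : k ≠ q) (φ : H) :
    ⁅cliffordPairing A ψ k q k, generator A P k k φ⁆ = generator A P k q φ := by
  have hsum : ⁅cliffordPairing A ψ k q k, generator A P k k φ⁆ =
      ∑ p, ⁅generator A P k q (modeVector A ψ p) * generator A P k k (A (modeVector A ψ p)),
        generator A P k k φ⁆ := by
    simp only [cliffordPairing, Ring.lie_def, Finset.sum_mul, Finset.mul_sum,
      Finset.sum_sub_distrib]
  rw [hsum]
  simp only [lie_generator_mul_generator hA hP hq, hA.involutive, ← map_smul, ← map_sum,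
    sum_inner_smul_modeVector ψ hA hP]

theorem sum_modeVector_conj (hA : IsSelfDual A) {M : Type*} [AddCommMonoid M] (f : H → H → M) :
    ∑ p, f (A (modeVector A ψ p)) (modeVector A ψ p) =
      ∑ p, f (modeVector A ψ p) (A (modeVector A ψ p)) := by
  simp only [Fintype.sum_prod_type, Fin.sum_univ_two]
  rw [add_comm]
  simp [modeVector, hA.involutive]

theorem lie_cliffordPairing (hA : IsSelfDual A) (hP : IsBasisProjection A P)
    (hq : k ≠ q) (hr : k ≠ r) :
    ⁅cliffordPairing A ψ k q k, cliffordPairing A ψ k r k⁆ = -cliffordPairing A ψ k q r := by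
  have hterm : ∀ p, ⁅cliffordPairing A ψ k q k,
      generator A P k r (modeVector A ψ p) * generator A P k k (A (modeVector A ψ p))⁆ =
      -(generator A P k q (A (modeVector A ψ p)) * generator A P k r (modeVector A ψ p)) :=
    fun p => by
      rw [generator_mul_swap hq, neg_neg, ← lie_cliffordPairing_generator ψ hA hP hq, Ring.lie_def,
        Ring.lie_def, ← mul_assoc, (commute_cliffordPairing_generator ψ hr _).eq]
      noncomm_ring
  have hsum : ⁅cliffordPairing A ψ k q k, cliffordPairing A ψ k r k⁆ =
      ∑ p, ⁅cliffordPairing A ψ k q k,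
        generator A P k r (modeVector A ψ p) * generator A P k k (A (modeVector A ψ p))⁆ := by
    rw [cliffordPairing.eq_def A ψ k r]
    simp only [Ring.lie_def, Finset.sum_mul, Finset.mul_sum, Finset.sum_sub_distrib]
  rw [hsum, Finset.sum_congr rfl fun p _ => hterm p, Finset.sum_neg_distrib,
    sum_modeVector_conj ψ hA fun x y => generator A P k q x * generator A P k r y]
  rfl

theorem modes_eq_copy (p : Fin 2 × Fin n) : modes A ψ q p = copy q (modeVector A ψ p) := by
  obtain ⟨i, j⟩ := p
  fin_cases i <;> rfl

theorem swapMatrix_mulVec_modes (hA : IsSelfDual A) (p : Fin 2 × Fin n) :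
    (swapMatrix ι H n).mulVec (modes A ψ q) p = copy q (A (modeVector A ψ p)) := by
  obtain ⟨i, j⟩ := p
  rw [swapMatrix, Matrix.mulVec, dotProduct, Fintype.sum_prod_type]
  fin_cases i <;> simp [Matrix.blockDiagonal_apply, modes, modeVector, hA.involutive]

theorem pairing_modes (hA : IsSelfDual A) :
    pairing (modes A ψ q) (modes A ψ r) =
      ∑ p, copy q (modeVector A ψ p) * copy r (A (modeVector A ψ p)) := by
  rw [pairing, dotProduct]
  exact Finset.sum_congr rfl fun p _ => by rw [modes_eq_copy, swapMatrix_mulVec_modes ψ hA]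

theorem toClifford_pairing (hA : IsSelfDual A) (hq : k ≠ q) :
    toClifford (contraction A P k) (pairing (modes A ψ q) (modes A ψ r)) =
      cliffordPairing A ψ k q r := by
  rw [pairing_modes ψ hA, map_sum]
  refine Finset.sum_congr rfl fun p _ => ?_
  rw [copy, toClifford_ι_mul, contraction_single_of_ne hq, map_zero, LinearMap.zero_apply, sub_zero,
    toClifford_copy]
  rfl

theorem grassStarₗ_pairing (hA : IsSelfDual A) :
    grassStarₗ A (pairing (modes A ψ q) (modes A ψ r)) =
      -pairing (modes A ψ q) (modes A ψ r) := by
  rw [pairing_modes ψ hA, map_sum]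
  simp only [grassStarₗ_mul, grassStarₗ_copy, hA.involutive]
  rw [← sum_modeVector_conj ψ hA fun x y => copy q x * copy r y, ← Finset.sum_neg_distrib]
  exact Finset.sum_congr rfl fun p _ =>
    eq_neg_of_add_eq_zero_left (ExteriorAlgebra.ι_add_mul_swap _ _)

theorem toClifford_neg_pairing (hA : IsSelfDual A) (hq : k ≠ q) :
    toClifford (contraction A P k) (-pairing (modes A ψ q) (modes A ψ r)) =
      -cliffordPairing A ψ k q r := by
  rw [map_neg, toClifford_pairing ψ hA hq]

variable [Fintype ι] (χ : OrthonormalBasis (Fin n) ℂ (LinearMap.range P))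

theorem toClifford_weyl (hA : IsSelfDual A) (hP : IsBasisProjection A P) (hq : k ≠ q) :
    toClifford (contraction A P k) (weyl A χ ψ k (modes A ψ q)) =
      IsNilpotent.exp (-cliffordPairing A ψ k q k) := by
  have himage := toClifford_neg_pairing (r := k) ψ hA hq
  rw [weyl, toClifford_circExp χ k hA hP, himage]
  exact himage ▸ (isNilpotent_cliffordPairing ψ hA hP hq).neg

theorem toClifford_grassStar_weyl (hA : IsSelfDual A) (hP : IsBasisProjection A P) (hq : k ≠ q) :
    toClifford (contraction A P k) (grassStar A (weyl A χ ψ k (modes A ψ q))) =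
      IsNilpotent.exp (cliffordPairing A ψ k q k) := by
  have himage := toClifford_neg_pairing (r := k) ψ hA hq
  rw [weyl, toClifford_grassStar_circExp χ k hA hP, himage, neg_neg]
  · exact himage ▸ (isNilpotent_cliffordPairing ψ hA hP hq).neg
  · rw [map_neg, grassStarₗ_pairing ψ hA]

theorem weyl_conj (hA : IsSelfDual A) (hP : IsBasisProjection A P) (hq : k ≠ q) (φ : H) :
    circ A χ k (circ A χ k (grassStar A (weyl A χ ψ k (modes A ψ q))) (copy k φ))
      (weyl A χ ψ k (modes A ψ q)) = copy k φ + copy q φ := by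
  apply (toClifford (contraction A P k)).injective
  have hlie := lie_cliffordPairing_generator ψ hA hP hq φ
  rw [toClifford_circ χ k hA hP, toClifford_circ χ k hA hP, toClifford_weyl ψ χ hA hP hq,
    toClifford_grassStar_weyl ψ χ hA hP hq, map_add, toClifford_copy, toClifford_copy,
    exp_mul_mul_exp_neg (isNilpotent_cliffordPairing ψ hA hP hq), hlie]
  exact hlie ▸ commute_cliffordPairing_generator ψ hq φ

theorem weyl_add (hA : IsSelfDual A) (hP : IsBasisProjection A P) (hq : k ≠ q) (hr : k ≠ r) :
    weyl A χ ψ k (modes A ψ q + modes A ψ r) =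
      circ A χ k (circ A χ k (weyl A χ ψ k (modes A ψ q)) (weyl A χ ψ k (modes A ψ r)))
        (circExp A χ k ((1 / 2 : ℂ) • pairing (modes A ψ q) (modes A ψ r))) := by
  apply (toClifford (contraction A P k)).injective
  set X := cliffordPairing A ψ k q k
  set Y := cliffordPairing A ψ k r k
  set Z := cliffordPairing A ψ k q r
  have hZ : IsNilpotent Z := isNilpotent_cliffordPairing_of_ne ψ hq hr
  have hlie : ⁅-X, -Y⁆ = -Z := by
    rw [Ring.lie_def, neg_mul_neg, neg_mul_neg, ← Ring.lie_def, lie_cliffordPairing ψ hA hP hq hr]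
  have hadd : toClifford (contraction A P k)
      (-pairing (modes A ψ q + modes A ψ r) (modes A ψ k)) = -X + -Y := by
    rw [pairing, add_dotProduct, map_neg, map_add, ← pairing, ← pairing,
      toClifford_pairing ψ hA hq, toClifford_pairing ψ hA hr, neg_add]
  have hhalf : toClifford (contraction A P k)
      ((1 / 2 : ℂ) • pairing (modes A ψ q) (modes A ψ r)) = -(1 / 2 : ℚ) • ⁅-X, -Y⁆ := by
    rw [map_smul, toClifford_pairing ψ hA hq, hlie, neg_smul_neg, one_div, one_div]
    exact_mod_cast inv_natCast_smul_eq ℂ ℚ 2 Z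
  have hnil : IsNilpotent (-(1 / 2 : ℚ) • ⁅-X, -Y⁆) := by rw [hlie]; exact hZ.neg.smul _
  obtain ⟨hXY, hexp⟩ := isNilpotent_add_and_exp_add
    (isNilpotent_cliffordPairing ψ hA hP hq).neg (isNilpotent_cliffordPairing ψ hA hP hr).neg
    (hlie ▸ hZ.neg) (hlie ▸ (commute_cliffordPairing ψ hq hr).neg_left.neg_right)
    (hlie ▸ (commute_cliffordPairing ψ hq hr).neg_left.neg_right)
  rw [toClifford_circ χ k hA hP, toClifford_circ χ k hA hP, toClifford_weyl ψ χ hA hP hq,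
    toClifford_weyl ψ χ hA hP hr, weyl, toClifford_circExp χ k hA hP (hadd ▸ hXY), hadd, hexp,
    toClifford_circExp χ k hA hP (hhalf ▸ hnil), hhalf]

end Displacement

end GrassmannWeyl

end

theorem mainTheorem5 {H : Type*} [NormedAddCommGroup H] [InnerProductSpace ℂ H]
    [FiniteDimensional ℂ H] (A : H →ₗ⋆[ℂ] H) (hA : GrassmannWeyl.IsSelfDual A)
    (P : H →ₗ[ℂ] H) (hP : GrassmannWeyl.IsBasisProjection A P) {n : ℕ}
    (χ ψ : OrthonormalBasis (Fin n) ℂ (LinearMap.range P)) {N : ℕ} (k l m : Fin (N + 1))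
    (hkl : k ≠ l) (hkm : k ≠ m) :
    (∀ i : Fin n,
      GrassmannWeyl.circ A χ k
          (GrassmannWeyl.circ A χ k
            (GrassmannWeyl.grassStar A
              (GrassmannWeyl.weyl A χ ψ k (GrassmannWeyl.modes A ψ l)))
            (GrassmannWeyl.copy k (ψ i : H)))
          (GrassmannWeyl.weyl A χ ψ k (GrassmannWeyl.modes A ψ l))
        = GrassmannWeyl.copy k (ψ i : H) + GrassmannWeyl.copy l (ψ i : H)) ∧
    (∀ i : Fin n,
      GrassmannWeyl.circ A χ k
          (GrassmannWeyl.circ A χ k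
            (GrassmannWeyl.grassStar A
              (GrassmannWeyl.weyl A χ ψ k (GrassmannWeyl.modes A ψ l)))
            (GrassmannWeyl.copy k (A (ψ i : H))))
          (GrassmannWeyl.weyl A χ ψ k (GrassmannWeyl.modes A ψ l))
        = GrassmannWeyl.copy k (A (ψ i : H)) + GrassmannWeyl.copy l (A (ψ i : H))) ∧
    ((fun p => GrassmannWeyl.circ A χ k
          (GrassmannWeyl.circ A χ k
            (GrassmannWeyl.grassStar A
              (GrassmannWeyl.weyl A χ ψ k (GrassmannWeyl.modes A ψ l)))
            (GrassmannWeyl.modes A ψ k p))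
          (GrassmannWeyl.weyl A χ ψ k (GrassmannWeyl.modes A ψ l)))
        = GrassmannWeyl.modes A ψ k + GrassmannWeyl.modes A ψ l) ∧
    GrassmannWeyl.weyl A χ ψ k (GrassmannWeyl.modes A ψ l + GrassmannWeyl.modes A ψ m)
      = GrassmannWeyl.circ A χ k
          (GrassmannWeyl.circ A χ k
            (GrassmannWeyl.weyl A χ ψ k (GrassmannWeyl.modes A ψ l))
            (GrassmannWeyl.weyl A χ ψ k (GrassmannWeyl.modes A ψ m)))
          (GrassmannWeyl.circExp A χ k
            ((1 / 2 : ℂ) • GrassmannWeyl.pairing (GrassmannWeyl.modes A ψ l)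
              (GrassmannWeyl.modes A ψ m))) := by
  refine ⟨fun i => ?_, fun i => ?_, funext fun p => ?_, ?_⟩
  · exact GrassmannWeyl.weyl_conj ψ χ hA hP hkl (ψ i : H)
  · exact GrassmannWeyl.weyl_conj ψ χ hA hP hkl (A (ψ i))
  · simp only [Pi.add_apply, GrassmannWeyl.modes_eq_copy]
    exact GrassmannWeyl.weyl_conj ψ χ hA hP hkl (GrassmannWeyl.modeVector A ψ p)
  · exact GrassmannWeyl.weyl_add ψ χ hA hP hkl hkm
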